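/- Let $\mathbb K$ be a field of characteristic $2$, let $\mathfrak g_0$ be a Lie algebra over $\mathbb K$ with a $2$-structure $x\mapsto x^{[2]}$ (that is, $[x^{[2]},y]=[x,[x,y]]$, $(ax)^{[2]}=a^2x^{[2]}$, $(x+y)^{[2]}=x^{[2]}+y^{[2]}+[x,y]$), and let $\mathfrak g_{-1}$ be a finite-dimensional restricted $\mathfrak g_0$-module, i.e. $\rho(x^{[2]})=\rho(x)^2$, with a basis indexed by $1,\dots,n$. Queerification. For a Lie algebra $\mathfrak a$ with $2$-structure, $\mathfrak q\mathfrak a=\mathfrak a\oplus\Pi(\mathfrak a)$ is the Lie superalgebra with even part $\mathfrak a$, odd part $\Pi(\mathfrak a)$, $[x,\Pi(y)]=\Pi([x,y])$ and $\Pi(x)^2=x^{[2]}$, so that $[\Pi(x),\Pi(y)]=[x,y]$. For a restricted $\mathfrak a$-module $M$, $\mathfrak qM=M\oplus\Pi(M)$ is the $\mathfrak q\mathfrak a$-module with $x\cdot\Pi(m)=\Pi(x)\cdot m=\Pi(xm)$ and $\Pi(x)\cdot\Pi(m)=xm$. Cartan prolongation. Let a Lie superalgebra $\mathfrak h_0$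 (possibly purely even) act on a finite-dimensional superspace $\mathfrak h_{-1}$ with a homogeneous basis, and let $\underline N$ be a shearing vector, with coordinates in $\{1,2,\dots,\infty\}$ for the even basis vectors. Let $\mathfrak{vect}(\underline N)$ be the $\mathbb Z$-graded Lie superalgebra of vector fields $\sum f_i\partial_i$, where the $f_i$ are divided power polynomials, with exponents $r_i<2^{N_i}$ of the even indeterminates and $\le 1$ of the odd ones, $\deg z_i=1$, $\deg\partial_i=-1$. Identify $\mathfrak h_{-1}$ with the constant fields, and let $\mathfrak h_0$ act through linear fields. The prolong $(\mathfrak h_{-1},\mathfrak h_0)_{*,\underline N}=\bigoplus_{k\ge-1}\mathfrak h_k$ has the constant fields in degree $-1$, the linear fields that represent $\mathfrak h_0$ in degree $0$ (a copy of $\mathfrak h_0$ if the module is faithful), and, for $k\ge1$, $\mathfrak h_k=\{D\in\mathfrak{vect}(\underline N)_k : [D,\partial_i]\in\mathfrak h_{k-1}\text{ for all }i\}$. Let $\mathfrak g=(\mathfrak g_{-1},\mathfrak g_0)_{*,\underline N_s}$ with $\underline N_s=(1,\dots,1)$; squaring of derivations, $D^{[2]}=D\circ D$, is a $2$-structure on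 $\mathfrak g$, so $\mathfrak q\mathfrak g$ is defined. Let $\mathfrak g\mathfrak q=(\mathfrak q\mathfrak g_{-1},\mathfrak q\mathfrak g_0)_{*,\underline N}$, where $\underline N\in\{1,2,\dots,\infty\}^n$ is an arbitrary shearing vector. Then the Lie superalgebras $\mathfrak q\mathfrak g$ and $\mathfrak g\mathfrak q$ coincide: there is an isomorphism of Lie superalgebras $\mathfrak q\mathfrak g\cong\mathfrak g\mathfrak q$ (compatible with brackets and with squaring of odd elements) that preserves the $\mathbb Z$-grading and is the identity on the non-positive parts, i.e. it sends $v$, $\Pi(v)$ (for $v\in\mathfrak g_{-1}$) and the images of $x$, $\Pi(x)$ (for $x\in\mathfrak g_0$) to the corresponding constant and linear fields. -/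

import Mathlib

namespace QueerProlong

set_option linter.unusedSectionVars false

noncomputable section

/-! ## Restricted Lie algebras and Lie superalgebras in characteristic 2 -/

section Abstract

variable (K : Type*) [Field K]

/-- A `2`-structure on a Lie algebra over a field of characteristic `2`. -/
class TwoStructure (L : Type*) [LieRing L] [LieAlgebra K L] where
  /-- the map `x ↦ x^[2]` -/
  sq : L → L
  sq_lie : ∀ x y : L, ⁅sq x, y⁆ = ⁅x, ⁅x, y⁆⁆
  sq_smul : ∀ (a : K) (x : L), sq (a • x) = a ^ 2 • sq x
  sq_add : ∀ x y : L, sq (x + y) = sq x + sq y + ⁅x, y⁆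

/-- A module `V` over a Lie algebra with `2`-structure is restricted if `ρ(x^[2]) = ρ(x)^2`. -/
class IsRestrictedModule (L : Type*) [LieRing L] [LieAlgebra K L] [TwoStructure K L]
    (V : Type*) [AddCommGroup V] [Module K V] [LieRingModule L V] [LieModule K L V] : Prop where
  sq_lie : ∀ (x : L) (v : V), ⁅TwoStructure.sq K x, v⁆ = ⁅x, ⁅x, v⁆⁆

/-- A Lie superalgebra over a field of characteristic `2`, with even part `E` and odd part `F`:
`E` is a Lie algebra, `F` is an `E`-module, and there is a squaring `F → E` with
`(a x)^2 = a^2 x^2`, whose polarization `[x, y] = (x + y)^2 - x^2 - y^2` is bilinear, and with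
`[x^2, y] = [x, [x, y]]` for every `x` in `F` and every `y` in `E` or in `F`
(there are no signs: `[x, e] = [e, x]`). -/
class LieSuperalgebraTwo (E F : Type*) [LieRing E] [LieAlgebra K E] [AddCommGroup F] [Module K F]
    [LieRingModule E F] [LieModule K E F] where
  /-- the squaring `x ↦ x^2` of odd elements -/
  sq : F → E
  /-- the bracket of two odd elements -/
  bracket : F →ₗ[K] F →ₗ[K] E
  sq_smul : ∀ (a : K) (x : F), sq (a • x) = a ^ 2 • sq x
  sq_add : ∀ x y : F, sq (x + y) = sq x + sq y + bracket x y
  sq_lie_even : ∀ (x : F) (e : E), ⁅sq x, e⁆ = bracket x ⁅e, x⁆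
  sq_lie_odd : ∀ x y : F, ⁅sq x, y⁆ = ⁅bracket x y, x⁆

/-- A module over a Lie superalgebra `E ⊕ F` over a field of characteristic `2`, with even part
`V₀` and odd part `V₁`. -/
class LieSupermoduleTwo (E F V₀ V₁ : Type*) [LieRing E] [LieAlgebra K E] [AddCommGroup F]
    [Module K F] [LieRingModule E F] [LieModule K E F] [LieSuperalgebraTwo K E F]
    [AddCommGroup V₀] [Module K V₀] [LieRingModule E V₀] [LieModule K E V₀]
    [AddCommGroup V₁] [Module K V₁] [LieRingModule E V₁] [LieModule K E V₁] where
  /-- the action of odd elements on even vectors -/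
  act₀ : F →ₗ[K] V₀ →ₗ[K] V₁
  /-- the action of odd elements on odd vectors -/
  act₁ : F →ₗ[K] V₁ →ₗ[K] V₀
  lie_act₀ : ∀ (e : E) (x : F) (v : V₀), ⁅e, act₀ x v⁆ = act₀ ⁅e, x⁆ v + act₀ x ⁅e, v⁆
  lie_act₁ : ∀ (e : E) (x : F) (v : V₁), ⁅e, act₁ x v⁆ = act₁ ⁅e, x⁆ v + act₁ x ⁅e, v⁆
  sq_act₀ : ∀ (x : F) (v : V₀), ⁅(LieSuperalgebraTwo.sq K x : E), v⁆ = act₁ x (act₀ x v)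
  sq_act₁ : ∀ (x : F) (v : V₁), ⁅(LieSuperalgebraTwo.sq K x : E), v⁆ = act₀ x (act₁ x v)

/-- Isomorphisms of Lie superalgebras `E ⊕ F ≃ E' ⊕ F'` over a field of characteristic `2`. -/
structure LieSuperEquivTwo (E F E' F' : Type*)
    [LieRing E] [LieAlgebra K E] [AddCommGroup F] [Module K F]
    [LieRingModule E F] [LieModule K E F] [LieSuperalgebraTwo K E F]
    [LieRing E'] [LieAlgebra K E'] [AddCommGroup F'] [Module K F']
    [LieRingModule E' F'] [LieModule K E' F'] [LieSuperalgebraTwo K E' F'] where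
  /-- the even component -/
  even : E ≃ₗ⁅K⁆ E'
  /-- the odd component -/
  odd : F ≃ₗ[K] F'
  map_lie : ∀ (e : E) (x : F), odd ⁅e, x⁆ = ⁅even e, odd x⁆
  map_sq : ∀ x : F, even (LieSuperalgebraTwo.sq K x) = LieSuperalgebraTwo.sq K (odd x)

end Abstract

theorem add_self (K : Type*) {M : Type*} [Field K] [CharP K 2] [AddCommGroup M] [Module K M]
    (x : M) : x + x = 0 := by
  rw [← two_smul K x, CharTwo.two_eq_zero, zero_smul]

theorem neg_self (K : Type*) {M : Type*} [Field K] [CharP K 2] [AddCommGroup M] [Module K M]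
    (x : M) : -x = x := neg_eq_of_add_eq_zero_left (add_self K x)

theorem sub_self_add (K : Type*) {M : Type*} [Field K] [CharP K 2] [AddCommGroup M] [Module K M]
    (x y : M) : x - y = x + y := by rw [sub_eq_add_neg, neg_self K]

/-! ## Queerification -/

section Queer

/-- The space `Π(X)`: a copy of `X` that is considered odd. -/
def ParityShift (X : Type*) := X

/-- The identification `x ↦ Π(x)`. -/
def toPi {X : Type*} (x : X) : ParityShift X := x

instance (X : Type*) [AddCommGroup X] : AddCommGroup (ParityShift X) :=
  inferInstanceAs (AddCommGroup X)

instance (K X : Type*) [Field K] [AddCommGroup X] [Module K X] : Module K (ParityShift X) :=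
  inferInstanceAs (Module K X)

/-- The basis of `Π(V)` that consists of the `Π(b_i)`. -/
def piBasis {K V ι : Type*} [Field K] [AddCommGroup V] [Module K V] (b : Module.Basis ι K V) :
    Module.Basis ι K (ParityShift V) :=
  b.map (LinearEquiv.refl K V : V ≃ₗ[K] V)

variable (K L V : Type*) [Field K] [LieRing L] [LieAlgebra K L] [AddCommGroup V]
  [Module K V] [LieRingModule L V] [LieModule K L V]

/-- `[x, Π(v)] = Π([x, v])`. -/
instance : LieRingModule L (ParityShift V) := inferInstanceAs (LieRingModule L V)

instance : LieModule K L (ParityShift V) := inferInstanceAs (LieModule K L V)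

/-- The bracket `[Π(x), Π(y)] = [x, y]`. -/
def queerBracket : ParityShift L →ₗ[K] ParityShift L →ₗ[K] L :=
  (LieModule.toEnd K L L : L →ₗ[K] L →ₗ[K] L)

/-- The queerification `𝔮(L) = L ⊕ Π(L)` of a Lie algebra with `2`-structure:
`[x, Π(y)] = Π([x, y])` and `Π(x)^2 = x^[2]`. -/
instance queerification [CharP K 2] [TwoStructure K L] :
    LieSuperalgebraTwo K L (ParityShift L) where
  sq := fun x : L => TwoStructure.sq K x
  bracket := queerBracket K L
  sq_smul := fun a (x : L) => TwoStructure.sq_smul a x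
  sq_add := fun (x y : L) => TwoStructure.sq_add x y
  sq_lie_even := fun (x e : L) => by
    change ⁅TwoStructure.sq K x, e⁆ = ⁅x, ⁅e, x⁆⁆
    rw [TwoStructure.sq_lie, ← lie_skew x e, lie_neg, neg_self K]
  sq_lie_odd := fun (x y : L) => by
    change ⁅TwoStructure.sq K x, y⁆ = ⁅⁅x, y⁆, x⁆
    rw [TwoStructure.sq_lie, ← lie_skew x ⁅x, y⁆, neg_self K]

/-- The action of `Π(L)` on `V ⊕ Π(V)`, up to the change of parity. -/
def queerAct : L →ₗ[K] V →ₗ[K] V := (LieModule.toEnd K L V : L →ₗ[K] V →ₗ[K] V)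

/-- The queerification `𝔮(V) = V ⊕ Π(V)` of a restricted `L`-module, a module over `𝔮(L)`:
`[x, Π(v)] = Π([x, v])`, `[Π(x), v] = Π([x, v])`, `[Π(x), Π(v)] = [x, v]`. -/
instance queerModule [CharP K 2] [TwoStructure K L] [IsRestrictedModule K L V] :
    LieSupermoduleTwo K L (ParityShift L) V (ParityShift V) where
  act₀ := (queerAct K L V : L →ₗ[K] V →ₗ[K] V)
  act₁ := (queerAct K L V : L →ₗ[K] V →ₗ[K] V)
  lie_act₀ := fun (e x : L) (v : V) => leibniz_lie e x v
  lie_act₁ := fun (e x : L) (v : V) => leibniz_lie e x v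
  sq_act₀ := fun (x : L) (v : V) => IsRestrictedModule.sq_lie (K := K) x v
  sq_act₁ := fun (x : L) (v : V) => IsRestrictedModule.sq_lie (K := K) x v

end Queer

/-! ## Divided powers -/

section DividedPowers

/-- The algebra of divided powers in the indeterminates `z_i`, `i ∈ κ`, with basis
`z^(r) = ∏ z_i^(r_i)`, `r : κ → ℕ`. -/
def DPoly (K : Type*) [Field K] (κ : Type*) := (κ → ℕ) →₀ K

variable {K : Type*} [Field K] {κ : Type*}

namespace DPoly

instance : AddCommGroup (DPoly K κ) := inferInstanceAs (AddCommGroup ((κ → ℕ) →₀ K))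

instance : Module K (DPoly K κ) := inferInstanceAs (Module K ((κ → ℕ) →₀ K))

/-- The element `a z^(r)`. -/
def mono (r : κ → ℕ) (a : K) : DPoly K κ := Finsupp.single r a

/-- The coefficient of `z^(r)`. -/
def coeff (r : κ → ℕ) : DPoly K κ →ₗ[K] K := (Finsupp.lapply r : ((κ → ℕ) →₀ K) →ₗ[K] K)

/-- The linear map with given values on the basis `z^(r)`. -/
def lift {M : Type*} [AddCommGroup M] [Module K M] (φ : (κ → ℕ) → M) : DPoly K κ →ₗ[K] M :=
  (Finsupp.linearCombination K φ : ((κ → ℕ) →₀ K) →ₗ[K] M)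

theorem lift_mono {M : Type*} [AddCommGroup M] [Module K M] (φ : (κ → ℕ) → M) (r : κ → ℕ)
    (a : K) : lift φ (mono r a) = a • φ r := Finsupp.linearCombination_single K a r

theorem ext {f g : DPoly K κ} (h : ∀ r, coeff r f = coeff r g) : f = g := Finsupp.ext h

theorem smul_mono (c : K) (r : κ → ℕ) (a : K) : c • mono r a = mono r (c * a) :=
  Finsupp.smul_single c r a

theorem mono_zero (r : κ → ℕ) : mono r (0 : K) = 0 := Finsupp.single_zero r

theorem mono_add (r : κ → ℕ) (a c : K) : mono r (a + c) = mono r a + mono r c :=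
  Finsupp.single_add r a c

theorem coeff_mono_same (r : κ → ℕ) (a : K) : coeff r (mono r a) = a := Finsupp.single_eq_same

theorem coeff_mono_ne {r s : κ → ℕ} (h : s ≠ r) (a : K) : coeff s (mono r a) = 0 :=
  Finsupp.single_eq_of_ne h

/-- The span of the `z^(r)` with `r ∈ S`. -/
def supported (S : Set (κ → ℕ)) : Submodule K (DPoly K κ) where
  carrier := {f | ∀ r, coeff r f ≠ 0 → r ∈ S}
  zero_mem' := fun r hr => absurd (map_zero _) hr
  add_mem' := fun {f g} hf hg r hr => by
    by_contra hS
    have h1 : coeff r f = 0 := by by_contra h; exact hS (hf r h)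
    have h2 : coeff r g = 0 := by by_contra h; exact hS (hg r h)
    exact hr (by rw [map_add, h1, h2, add_zero])
  smul_mem' := fun c f hf r hr => hf r fun h => hr (by rw [map_smul, h, smul_zero])

theorem mono_mem_supported {S : Set (κ → ℕ)} {r : κ → ℕ} (h : r ∈ S) (a : K) :
    mono r a ∈ supported (K := K) S := by
  intro s hs
  by_cases e : s = r
  · rwa [e]
  · exact absurd (coeff_mono_ne e a) hs

theorem supported_induction {S : Set (κ → ℕ)} {P : DPoly K κ → Prop} (h0 : P 0)
    (hadd : ∀ f g, P f → P g → P (f + g)) (hm : ∀ r ∈ S, ∀ a, P (mono r a))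
    (f : DPoly K κ) (hf : f ∈ supported S) : P f := by
  have key : f = ∑ r ∈ (Finsupp.support (f : (κ → ℕ) →₀ K)), mono r (coeff r f) :=
    (Finsupp.sum_single (f : (κ → ℕ) →₀ K)).symm
  rw [key]
  refine Finset.sum_induction _ P hadd h0 fun r hr => hm r (hf r ?_) _
  exact Finsupp.mem_support_iff.1 hr

theorem induction {P : DPoly K κ → Prop} (h0 : P 0)
    (hadd : ∀ f g, P f → P g → P (f + g)) (hm : ∀ r a, P (mono r a)) (f : DPoly K κ) : P f :=
  supported_induction (S := Set.univ) h0 hadd (fun r _ a => hm r a) f fun _ _ => trivial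

variable [Fintype κ]

/-- `∏ binom(r_i + s_i, r_i)`. -/
def binom (r s : κ → ℕ) : ℕ := ∏ i, (r i + s i).choose (r i)

/-- The multiplication `z^(r) z^(s) = ∏ binom(r_i + s_i, r_i) z^(r + s)`. -/
def mulLin : DPoly K κ →ₗ[K] DPoly K κ →ₗ[K] DPoly K κ :=
  lift fun r => lift fun s => mono (r + s) (binom r s : K)

theorem mulLin_mono (r s : κ → ℕ) (a c : K) :
    mulLin (mono r a) (mono s c) = mono (r + s) (a * c * (binom r s : K)) := by
  simp only [mulLin, lift_mono, LinearMap.smul_apply, smul_mono]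
  ring_nf

theorem binom_comm (r s : κ → ℕ) : binom r s = binom s r := by
  refine Finset.prod_congr rfl fun i _ => ?_
  rw [add_comm (s i), Nat.choose_symm_add]

theorem binom_assoc (r s t : κ → ℕ) :
    binom r s * binom (r + s) t = binom s t * binom r (s + t) := by
  simp only [binom, ← Finset.prod_mul_distrib]
  refine Finset.prod_congr rfl fun i _ => ?_
  simp only [Pi.add_apply]
  have h := Nat.choose_mul (n := r i + s i + t i) (k := r i + s i) (s := r i) (by omega)
  have e1 : r i + s i + t i - r i = s i + t i := by omega
  have e2 : r i + s i - r i = s i := by omega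
  rw [e1, e2] at h
  rw [← add_assoc (r i) (s i) (t i)]
  linarith

theorem binom_zero_left (s : κ → ℕ) : binom 0 s = 1 := by simp [binom]

instance : Mul (DPoly K κ) := ⟨fun f g => mulLin f g⟩

instance : One (DPoly K κ) := ⟨mono 0 1⟩

theorem mul_def (f g : DPoly K κ) : f * g = mulLin f g := rfl

theorem one_def : (1 : DPoly K κ) = mono 0 1 := rfl

theorem mono_mul_mono (r s : κ → ℕ) (a c : K) :
    mono r a * mono s c = mono (r + s) (a * c * (binom r s : K)) := mulLin_mono r s a c

theorem mul_add' (f g h : DPoly K κ) : f * (g + h) = f * g + f * h := by simp [mul_def]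

theorem add_mul' (f g h : DPoly K κ) : (f + g) * h = f * h + g * h := by simp [mul_def]

theorem zero_mul' (f : DPoly K κ) : 0 * f = 0 := by simp [mul_def]

theorem mul_zero' (f : DPoly K κ) : f * 0 = 0 := by simp [mul_def]

theorem mul_comm' (f g : DPoly K κ) : f * g = g * f := by
  induction f using induction with
  | h0 => rw [zero_mul', mul_zero']
  | hadd f₁ f₂ h1 h2 => rw [add_mul', mul_add', h1, h2]
  | hm r a =>
    induction g using induction with
    | h0 => rw [zero_mul', mul_zero']
    | hadd f₁ f₂ h1 h2 => rw [add_mul', mul_add', h1, h2]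
    | hm s c => rw [mono_mul_mono, mono_mul_mono, add_comm, binom_comm, mul_comm a]

theorem one_mul' (f : DPoly K κ) : 1 * f = f := by
  induction f using induction with
  | h0 => rw [mul_zero']
  | hadd f₁ f₂ h1 h2 => rw [mul_add', h1, h2]
  | hm s c => rw [one_def, mono_mul_mono, binom_zero_left]; simp

theorem mul_assoc' (f g h : DPoly K κ) : f * g * h = f * (g * h) := by
  induction f using induction with
  | h0 => simp only [zero_mul']
  | hadd f₁ f₂ h1 h2 => simp only [add_mul', h1, h2]
  | hm r a =>
    induction g using induction with
    | h0 => simp only [zero_mul', mul_zero']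
    | hadd f₁ f₂ h1 h2 => simp only [add_mul', mul_add', h1, h2]
    | hm s c =>
      induction h using induction with
      | h0 => simp only [mul_zero']
      | hadd f₁ f₂ h1 h2 => simp only [mul_add', h1, h2]
      | hm t d =>
        simp only [mono_mul_mono, add_assoc]
        congr 1
        have := congrArg (Nat.cast : ℕ → K) (binom_assoc r s t)
        push_cast at this
        linear_combination (a * c * d) * this

instance : CommRing (DPoly K κ) where
  __ := (inferInstance : AddCommGroup (DPoly K κ))
  mul_assoc := mul_assoc'
  mul_comm := mul_comm'
  one_mul := one_mul'
  mul_one := fun f => by rw [mul_comm', one_mul']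
  left_distrib := mul_add'
  right_distrib := add_mul'
  zero_mul := zero_mul'
  mul_zero := mul_zero'

instance : Algebra K (DPoly K κ) :=
  Algebra.ofModule (fun c f g => by simp [mul_def]) (fun c f g => by simp [mul_def])

theorem mul_mem_supported {S T U : Set (κ → ℕ)}
    (h : ∀ r ∈ S, ∀ s ∈ T, r + s ∈ U ∨ (binom r s : K) = 0) {f g : DPoly K κ}
    (hf : f ∈ supported S) (hg : g ∈ supported T) : f * g ∈ supported (K := K) U := by
  refine supported_induction (S := S) (P := fun f => f * g ∈ supported (K := K) U) ?_ ?_ ?_ f hf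
  · rw [zero_mul]; exact zero_mem _
  · intro f₁ f₂ h1 h2; rw [add_mul]; exact add_mem h1 h2
  · intro r hr a
    refine supported_induction (S := T) (P := fun g => mono r a * g ∈ supported (K := K) U)
      ?_ ?_ ?_ g hg
    · rw [mul_zero]; exact zero_mem _
    · intro f₁ f₂ h1 h2; rw [mul_add]; exact add_mem h1 h2
    · intro s hs c
      rw [mono_mul_mono]
      rcases h r hr s hs with h | h
      · exact mono_mem_supported h _
      · rw [h, mul_zero, mono_zero]; exact zero_mem _

theorem binom_self_even {r : κ → ℕ} (hr : r ≠ 0) [CharP K 2] : (binom r r : K) = 0 := by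
  obtain ⟨i, hi⟩ := Function.ne_iff.1 hr
  have h : 2 ∣ (r i + r i).choose (r i) := by
    rw [← two_mul]
    exact Nat.two_dvd_centralBinom_of_one_le (Nat.pos_of_ne_zero hi)
  rw [CharP.cast_eq_zero_iff K 2]
  exact h.trans (Finset.dvd_prod_of_mem (fun i => (r i + r i).choose (r i)) (Finset.mem_univ i))

theorem mul_self_eq_zero' [CharP K 2] {f : DPoly K κ} (hf : f ∈ supported {r | r ≠ 0}) :
    f * f = 0 := by
  refine supported_induction (S := {r | r ≠ 0}) (P := fun f => f * f = 0) ?_ ?_ ?_ f hf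
  · rw [zero_mul]
  · intro f₁ f₂ h1 h2
    have : (f₁ + f₂) * (f₁ + f₂) = f₁ * f₁ + f₂ * f₂ + (f₁ * f₂ + f₁ * f₂) := by ring
    rw [this, h1, h2, add_self K (f₁ * f₂), add_zero, add_zero]
  · intro r hr a
    rw [mono_mul_mono, binom_self_even hr, mul_zero, mono_zero]

variable [DecidableEq κ]

/-- The partial derivative `∂_i`: the coefficient of `z^(r)` in `∂_i f` is that of `z^(r + e_i)` in
`f`, so that `∂_i z^(r) = z^(r - e_i)`, or `0` if `r_i = 0`. -/
def pdLin (i : κ) : DPoly K κ →ₗ[K] DPoly K κ :=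
  (Finsupp.lcomapDomain (fun r : κ → ℕ => r + Pi.single i 1) (add_left_injective _) :
    ((κ → ℕ) →₀ K) →ₗ[K] ((κ → ℕ) →₀ K))

theorem coeff_pdLin (i : κ) (f : DPoly K κ) (r : κ → ℕ) :
    coeff r (pdLin i f) = coeff (r + Pi.single i 1) f := rfl

theorem pdLin_mono_add (i : κ) (r : κ → ℕ) (a : K) :
    pdLin i (mono (r + Pi.single i 1) a) = mono r a := by
  refine ext fun s => ?_
  rw [coeff_pdLin]
  by_cases h : s = r
  · rw [h, coeff_mono_same, coeff_mono_same]
  · rw [coeff_mono_ne h, coeff_mono_ne]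
    exact fun e => h (add_left_injective _ e)

theorem pdLin_mono_of_zero (i : κ) (r : κ → ℕ) (a : K) (hr : r i = 0) :
    pdLin i (mono r a) = 0 := by
  refine ext fun s => ?_
  rw [coeff_pdLin, coeff_mono_ne, map_zero]
  intro h
  have := congrFun h i
  simp [hr] at this

theorem exists_add_single {r : κ → ℕ} {i : κ} (h : r i ≠ 0) :
    ∃ s : κ → ℕ, r = s + Pi.single i 1 := by
  refine ⟨r - Pi.single i 1, ?_⟩
  funext j
  by_cases e : j = i
  · subst e; simp; omega
  · simp [e]

theorem binom_single_left {r s : κ → ℕ} {i : κ} (h : s i = 0) :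
    binom (r + Pi.single i 1) s = binom r s := by
  refine Finset.prod_congr rfl fun j _ => ?_
  by_cases e : j = i
  · subst e; simp [h]
  · simp [e]

theorem binom_pascal (r s : κ → ℕ) (i : κ) :
    binom (r + Pi.single i 1) (s + Pi.single i 1) =
      binom (r + Pi.single i 1) s + binom r (s + Pi.single i 1) := by
  have split : ∀ u v : κ → ℕ, binom u v = (u i + v i).choose (u i) *
      ∏ j ∈ Finset.univ.erase i, (u j + v j).choose (u j) := fun u v =>
    (Finset.mul_prod_erase _ _ (Finset.mem_univ i)).symm
  have rest : ∀ u v u' v' : κ → ℕ, (∀ j ≠ i, u j = u' j) → (∀ j ≠ i, v j = v' j) →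
      ∏ j ∈ Finset.univ.erase i, (u j + v j).choose (u j) =
      ∏ j ∈ Finset.univ.erase i, (u' j + v' j).choose (u' j) := fun u v u' v' h h' =>
    Finset.prod_congr rfl fun j hj => by
      rw [h j (Finset.ne_of_mem_erase hj), h' j (Finset.ne_of_mem_erase hj)]
  have hs : ∀ u : κ → ℕ, ∀ j ≠ i, (u + (Pi.single i 1 : κ → ℕ)) j = u j := fun u j hj => by simp [hj]
  rw [split, split (r + Pi.single i 1) s, split r (s + Pi.single i 1),
    rest _ _ r s (hs r) (hs s), rest _ _ r s (hs r) (fun _ _ => rfl),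
    rest _ _ r s (fun _ _ => rfl) (hs s), ← add_mul]
  congr 1
  simp only [Pi.add_apply, Pi.single_eq_same]
  rw [show r i + 1 + (s i + 1) = (r i + s i + 1) + 1 by ring, Nat.choose_succ_succ', add_comm]
  congr 2
  ring

theorem pdLin_mul (i : κ) (f g : DPoly K κ) :
    pdLin i (f * g) = f * pdLin i g + g * pdLin i f := by
  induction f using induction with
  | h0 => simp
  | hadd f₁ f₂ h1 h2 => rw [add_mul, map_add, h1, h2, map_add]; ring
  | hm r a =>
    induction g using induction with
    | h0 => simp
    | hadd f₁ f₂ h1 h2 => rw [mul_add, map_add, h1, h2, map_add]; ring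
    | hm s c =>
      by_cases hr : r i = 0 <;> by_cases hs : s i = 0
      · rw [mono_mul_mono, pdLin_mono_of_zero i r a hr, pdLin_mono_of_zero i s c hs,
          pdLin_mono_of_zero _ _ _ (by simp [hr, hs])]
        simp
      · obtain ⟨s, rfl⟩ := exists_add_single hs
        rw [mono_mul_mono, pdLin_mono_of_zero i r a hr, pdLin_mono_add, mono_mul_mono,
          ← add_assoc, pdLin_mono_add, mul_zero, add_zero, binom_comm, binom_single_left hr,
          binom_comm]
      · obtain ⟨r, rfl⟩ := exists_add_single hr
        rw [mono_mul_mono, pdLin_mono_of_zero i s c hs, pdLin_mono_add, mono_mul_mono,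
          add_right_comm, pdLin_mono_add, mul_zero, zero_add, binom_single_left hs, add_comm s,
          mul_comm c, binom_comm s]
      · obtain ⟨s, rfl⟩ := exists_add_single hs
        obtain ⟨r, rfl⟩ := exists_add_single hr
        rw [mono_mul_mono, pdLin_mono_add, pdLin_mono_add, mono_mul_mono, mono_mul_mono,
          ← add_assoc, pdLin_mono_add, binom_pascal, add_right_comm s, add_comm s r,
          add_right_comm r, ← mono_add, binom_comm r]
        congr 1
        rw [binom_comm (s + Pi.single i 1)]
        push_cast
        ring

theorem pdLin_mem_supported {S T : Set (κ → ℕ)} (i : κ)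
    (h : ∀ r, r + Pi.single i 1 ∈ S → r ∈ T) {f : DPoly K κ} (hf : f ∈ supported S) :
    pdLin i f ∈ supported (K := K) T := fun r hr => h r (hf _ (by rwa [coeff_pdLin] at hr))

end DPoly

end DividedPowers

/-! ## Vector fields with divided power coefficients, in characteristic 2 -/

section VectorFields

open DPoly

theorem two_dvd_choose_of_pow {a c m : ℕ} (ha : a < 2 ^ m) (hc : c < 2 ^ m) (h : 2 ^ m ≤ c + a) :
    2 ∣ (c + a).choose a := by
  have hm : m ≠ 0 := by rintro rfl; simp at ha hc h; omega
  refine Nat.dvd_of_factorization_pos (Nat.pos_iff_ne_zero.1 ?_)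
  rw [Nat.factorization_choose' Nat.prime_two (Nat.lt_succ_self _)]
  refine Finset.card_pos.2 ⟨m, ?_⟩
  rw [Finset.mem_filter, Finset.mem_Ico, Nat.mod_eq_of_lt ha, Nat.mod_eq_of_lt hc]
  refine ⟨⟨Nat.pos_of_ne_zero hm, Nat.lt_succ_of_le ?_⟩, by omega⟩
  exact Nat.le_log_of_pow_le (by norm_num) h

/-- The exponents `r` with `r_i < 2^(N_i)` for every `i`, where the coordinates of the shearing
vector `N` are positive integers or infinite. -/
def box {κ : Type*} (N : κ → WithTop ℕ+) : Set (κ → ℕ) :=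
  {r | ∀ i, ∀ m : ℕ+, N i ≤ m → r i < 2 ^ (m : ℕ)}

variable (K : Type*) [Field K] [CharP K 2] {κ : Type*} [Fintype κ]

/-- The algebra `𝒪(κ; N)` of divided powers with shearing vector `N`, spanned by the `z^(r)` with
`r_i < 2^(N_i)`.

In characteristic `2` an odd indeterminate `ξ` commutes with all others, and `ξ^2 = 0`, so it
generates the same algebra as an even indeterminate with coordinate `1` of the shearing vector.
Thus the superalgebra of divided powers in even and odd indeterminates is `𝒪(κ; N)` with `N_i = 1`
for the odd indeterminates, together with a parity `κ → ZMod 2`. -/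
def truncated (N : κ → WithTop ℕ+) : Subalgebra K (DPoly K κ) where
  __ := supported (K := K) (box N)
  mul_mem' := fun {f g} hf hg => by
    refine mul_mem_supported (S := box N) (T := box N) (fun r hr s hs => ?_) hf hg
    by_cases h : r + s ∈ box N
    · exact Or.inl h
    · right
      simp only [box, Set.mem_ofPred_eq, not_forall] at h
      obtain ⟨i, m, hm, h⟩ := h
      rw [CharP.cast_eq_zero_iff K 2]
      refine Dvd.dvd.trans ?_ (Finset.dvd_prod_of_mem _ (Finset.mem_univ i))
      rw [add_comm (r i)]
      exact two_dvd_choose_of_pow (hr i m hm) (hs i m hm) (by simp at h; omega)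
  algebraMap_mem' := fun c => by
    rw [Algebra.algebraMap_eq_smul_one]
    refine (supported (K := K) (box N)).smul_mem c (mono_mem_supported (fun i m _ => ?_) 1)
    simp

variable [DecidableEq κ] {N : κ → WithTop ℕ+}

theorem box_of_add {r s : κ → ℕ} (h : r + s ∈ box N) : r ∈ box N := fun i m hm =>
  lt_of_le_of_lt (Nat.le_add_right _ _) (h i m hm)

/-- The Lie algebra of derivations of `𝒪(κ; N)` (the bracket is the commutator). -/
abbrev Der (N : κ → WithTop ℕ+) : Type _ := Derivation K (truncated K N) (truncated K N)

/-- The indeterminate `z_i` in `𝒪(κ; N)`. -/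
def z (N : κ → WithTop ℕ+) (i : κ) : truncated K N :=
  ⟨mono (Pi.single i 1) 1, mono_mem_supported (fun j m _ => by
    have : (Pi.single i 1 : κ → ℕ) j ≤ 1 := by
      by_cases e : j = i
      · subst e; simp
      · simp [e]
    exact lt_of_le_of_lt this (Nat.one_lt_two_pow m.ne_zero)) 1⟩

/-- The derivation `∂_i` of `𝒪(κ; N)`. -/
def pd (N : κ → WithTop ℕ+) (i : κ) : Der K N :=
  Derivation.mk'
    ((pdLin i ∘ₗ (truncated K N).val.toLinearMap).codRestrict
      (Subalgebra.toSubmodule (truncated K N))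
      fun f => pdLin_mem_supported i (fun _ h => box_of_add h) f.2)
    fun f g => Subtype.ext (pdLin_mul i f.1 g.1)

variable {K}

theorem coe_pd (i : κ) (f : truncated K N) : (pd K N i f : DPoly K κ) = pdLin i f.1 := rfl

theorem pd_comm (i j : κ) (f : truncated K N) : pd K N i (pd K N j f) = pd K N j (pd K N i f) := by
  refine Subtype.ext (DPoly.ext fun r => ?_)
  simp only [coe_pd, coeff_pdLin]
  rw [add_right_comm]

theorem pd_z (i j : κ) : pd K N i (z K N j) = if i = j then 1 else 0 := by
  refine Subtype.ext ?_
  rw [coe_pd]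
  split_ifs with h
  · subst h
    have := pdLin_mono_add i 0 (1 : K)
    rwa [zero_add] at this
  · exact pdLin_mono_of_zero i _ _ (by simp [h])

theorem pd_pd_of_one (i : κ) (h : N i = 1) (f : truncated K N) :
    pd K N i (pd K N i f) = 0 := by
  refine Subtype.ext (DPoly.ext fun r => ?_)
  simp only [coe_pd, coeff_pdLin]
  by_contra hc
  have := f.2 _ hc i 1 (by rw [h]; rfl)
  simp at this

theorem der_sum_apply {σ : Type*} (s : Finset σ) (D : σ → Der K N) (f : truncated K N) :
    (∑ i ∈ s, D i) f = ∑ i ∈ s, D i f :=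
  map_sum ((Pi.evalAddMonoidHom (fun _ => truncated K N) f).comp
    (Derivation.coeFnAddMonoidHom : Der K N →+ (truncated K N → truncated K N))) D s

variable {M : Type*} [AddCommGroup M]

variable (K N) in
/-- The elements of `𝒪(κ; N)` of weight `d`, where `z_i` has weight `w i`. -/
def homog (w : κ → M) (d : M) : Submodule K (truncated K N) :=
  (supported {r | ∑ i, r i • w i = d}).comap (truncated K N).val.toLinearMap

theorem mul_mem_homog {w : κ → M} {d e : M} {f g : truncated K N} (hf : f ∈ homog K N w d)
    (hg : g ∈ homog K N w e) : f * g ∈ homog K N w (d + e) :=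
  mul_mem_supported (fun r hr s hs => Or.inl (by
    simp only [Set.mem_ofPred_eq] at hr hs ⊢
    simp only [Pi.add_apply, add_smul, Finset.sum_add_distrib, hr, hs])) hf hg

theorem pd_mem_homog {w : κ → M} {d : M} (i : κ) {f : truncated K N} (hf : f ∈ homog K N w d) :
    pd K N i f ∈ homog K N w (d - w i) :=
  pdLin_mem_supported i (fun r hr => by
    simp only [Set.mem_ofPred_eq] at hr ⊢
    rw [← hr]
    simp only [Pi.add_apply, add_smul, Finset.sum_add_distrib]
    rw [Finset.sum_eq_single (f := fun x => (Pi.single i 1 : κ → ℕ) x • w x) i]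
    · simp
    · intro j _ hj; simp [hj]
    · simp) hf

theorem mul_self_eq_zero_of_homog {w : κ → M} {d : M} (hd : d ≠ 0) {f : truncated K N}
    (hf : f ∈ homog K N w d) : f * f = 0 := by
  refine Subtype.ext (mul_self_eq_zero' (f := f.1) fun r hr => ?_)
  rintro rfl
  have h : ∑ i, (0 : κ → ℕ) i • w i = d := hf _ hr
  simp at h
  exact hd h.symm

variable (K N) in
/-- The vector fields `∑ f_i ∂_i`, with `f_i = D(z_i)`, of weight `d`, where `z_i` has weight `w i`
and `∂_i` has weight `-w i`. -/
def vect (w : κ → M) (d : M) : Submodule K (Der K N) where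
  carrier := {D | D = ∑ i, D (z K N i) • pd K N i ∧ ∀ i, D (z K N i) ∈ homog K N w (d + w i)}
  zero_mem' := ⟨by simp, fun i => zero_mem _⟩
  add_mem' := fun {D E} hD hE => by
    refine ⟨?_, fun i => add_mem (hD.2 i) (hE.2 i)⟩
    simp only [Derivation.add_apply, add_smul, Finset.sum_add_distrib]
    rw [← hD.1, ← hE.1]
  smul_mem' := fun c D hD => by
    refine ⟨?_, fun i => Submodule.smul_mem _ c (hD.2 i)⟩
    simp only [Derivation.smul_apply, smul_assoc, ← Finset.smul_sum]
    rw [← hD.1]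

theorem vect_apply {w : κ → M} {d : M} {D : Der K N} (hD : D ∈ vect K N w d) (f : truncated K N) :
    D f = ∑ i, D (z K N i) * pd K N i f := by
  conv_lhs => rw [hD.1]
  simp [der_sum_apply]

theorem vect_ext {w : κ → M} {d : M} {D E : Der K N} {w' : κ → M} {d' : M}
    (hD : D ∈ vect K N w d) (hE : E ∈ vect K N w' d')
    (h : ∀ i, D (z K N i) = E (z K N i)) : D = E := by
  rw [hD.1, hE.1]; simp only [h]

theorem vect_of_apply {w : κ → M} {d : M} {D : Der K N}
    (h : ∀ f, D f = ∑ i, D (z K N i) * pd K N i f)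
    (h' : ∀ i, D (z K N i) ∈ homog K N w (d + w i)) : D ∈ vect K N w d := by
  refine ⟨Derivation.ext fun f => ?_, h'⟩
  rw [h f]; simp [der_sum_apply]

theorem apply_mem_homog {w : κ → M} {d e : M} {D : Der K N} (hD : D ∈ vect K N w d)
    {f : truncated K N} (hf : f ∈ homog K N w e) : D f ∈ homog K N w (d + e) := by
  rw [vect_apply hD]
  refine sum_mem fun i _ => ?_
  have := mul_mem_homog (hD.2 i) (pd_mem_homog i hf)
  rwa [add_add_sub_cancel] at this

theorem z_mem_homog (w : κ → M) (i : κ) : z K N i ∈ homog K N w (w i) :=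
  mono_mem_supported (by
    simp only [Set.mem_ofPred_eq]
    rw [Finset.sum_eq_single i]
    · simp
    · intro j _ hj; simp [hj]
    · simp) 1

theorem one_mem_homog (w : κ → M) : (1 : truncated K N) ∈ homog K N w 0 :=
  mono_mem_supported (by simp) 1

theorem pd_mem_vect (w : κ → M) (i : κ) : pd K N i ∈ vect K N w (-w i) := by
  refine vect_of_apply (fun f => ?_) fun j => ?_
  · simp [pd_z]
  · rw [pd_z]
    split_ifs with h
    · subst h; rw [neg_add_cancel]; exact one_mem_homog w
    · exact zero_mem _

theorem lie_mem_vect {w : κ → M} {d e : M} {D E : Der K N} (hD : D ∈ vect K N w d)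
    (hE : E ∈ vect K N w e) : ⁅D, E⁆ ∈ vect K N w (d + e) := by
  refine vect_of_apply (fun f => ?_) fun i => ?_
  · simp only [Derivation.commutator_apply]
    have h1 : D (E f) = ∑ i, D (E (z K N i)) * pd K N i f +
        ∑ i, ∑ j, E (z K N i) * D (z K N j) * pd K N j (pd K N i f) := by
      rw [vect_apply hE f, map_sum, ← Finset.sum_add_distrib]
      refine Finset.sum_congr rfl fun i _ => ?_
      rw [Derivation.leibniz, vect_apply hD (pd K N i f), smul_eq_mul, smul_eq_mul, Finset.mul_sum,
        add_comm, mul_comm]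
      simp only [mul_assoc]
    have h2 : E (D f) = ∑ i, E (D (z K N i)) * pd K N i f +
        ∑ i, ∑ j, E (z K N i) * D (z K N j) * pd K N j (pd K N i f) := by
      rw [vect_apply hD f, map_sum, Finset.sum_comm, ← Finset.sum_add_distrib]
      refine Finset.sum_congr rfl fun i _ => ?_
      rw [Derivation.leibniz, vect_apply hE (pd K N i f), smul_eq_mul, smul_eq_mul, Finset.mul_sum,
        add_comm, mul_comm]
      congr 1
      refine Finset.sum_congr rfl fun j _ => ?_
      rw [pd_comm j i]; ring
    rw [h1, h2]
    simp only [sub_mul, Finset.sum_sub_distrib]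
    ring
  · rw [Derivation.commutator_apply]
    refine sub_mem ?_ ?_
    · rw [add_assoc]; exact apply_mem_homog hD (hE.2 i)
    · rw [add_comm d, add_assoc]; exact apply_mem_homog hE (hD.2 i)

theorem zero_der_lie (E : Der K N) : ⁅(0 : Der K N), E⁆ = 0 := zero_lie E

theorem add_der_lie (D D' E : Der K N) : ⁅D + D', E⁆ = ⁅D, E⁆ + ⁅D', E⁆ := add_lie D D' E

theorem smul_der_lie (c : K) (D E : Der K N) : ⁅c • D, E⁆ = c • ⁅D, E⁆ := smul_lie c D E

theorem der_lie_add (D E E' : Der K N) : ⁅D, E + E'⁆ = ⁅D, E⁆ + ⁅D, E'⁆ := lie_add D E E'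

theorem der_lie_zero (D : Der K N) : ⁅D, (0 : Der K N)⁆ = 0 := lie_zero D

theorem der_lie_smul (c : K) (D E : Der K N) : ⁅D, c • E⁆ = c • ⁅D, E⁆ := lie_smul c D E

theorem der_lie_sum {σ : Type*} (s : Finset σ) (D : Der K N) (E : σ → Der K N) :
    ⁅D, ∑ i ∈ s, E i⁆ = ∑ i ∈ s, ⁅D, E i⁆ := lie_sum s E D

theorem der_lie_lie (D E F : Der K N) : ⁅⁅D, E⁆, F⁆ = ⁅D, ⁅E, F⁆⁆ - ⁅E, ⁅D, F⁆⁆ := lie_lie D E F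

theorem der_leibniz_lie (D E F : Der K N) : ⁅D, ⁅E, F⁆⁆ = ⁅⁅D, E⁆, F⁆ + ⁅E, ⁅D, F⁆⁆ := by
  rw [der_lie_lie, sub_add_cancel]

/-- The square `D ∘ D` of a derivation, which is a derivation in characteristic `2`. -/
def derSq (D : Der K N) : Der K N :=
  Derivation.mk' ((D : truncated K N →ₗ[K] truncated K N) ∘ₗ D) fun f g => by
    simp only [LinearMap.comp_apply, Derivation.coeFn_coe, Derivation.leibniz, map_add,
      smul_eq_mul]
    have := add_self K (D f * D g)
    linear_combination this

theorem derSq_apply (D : Der K N) (f : truncated K N) : derSq D f = D (D f) := rfl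

theorem derSq_smul (a : K) (D : Der K N) : derSq (a • D) = a ^ 2 • derSq D := by
  ext f : 1
  simp [derSq_apply, smul_smul, pow_two]

theorem derSq_add (D E : Der K N) : derSq (D + E) = derSq D + derSq E + ⁅D, E⁆ := by
  ext f : 1
  simp only [derSq_apply, Derivation.add_apply, map_add, Derivation.commutator_apply]
  rw [sub_self_add K]
  abel

theorem derSq_lie (D E : Der K N) : ⁅derSq D, E⁆ = ⁅D, ⁅D, E⁆⁆ := by
  ext f : 1
  simp only [derSq_apply, Derivation.commutator_apply, map_sub]
  have := add_self K (D (E (D f)))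
  simp only [sub_self_add K]
  rw [show D (D (E f)) + D (E (D f)) + (D (E (D f)) + E (D (D f))) =
    D (D (E f)) + (D (E (D f)) + D (E (D f))) + E (D (D f)) by abel, this, add_zero]

theorem derSq_mem_vect {w : κ → M} {d : M} {D : Der K N} (hD : D ∈ vect K N w d)
    (h : ∀ i, D (z K N i) * D (z K N i) = 0 ∨ N i = 1) : derSq D ∈ vect K N w (d + d) := by
  refine vect_of_apply (fun f => ?_) fun i => ?_
  · simp only [derSq_apply]
    have h1 : D (D f) = ∑ i, D (D (z K N i)) * pd K N i f +
        ∑ p : κ × κ, D (z K N p.1) * D (z K N p.2) * pd K N p.2 (pd K N p.1 f) := by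
      rw [Fintype.sum_prod_type, vect_apply hD f, map_sum, ← Finset.sum_add_distrib]
      refine Finset.sum_congr rfl fun i _ => ?_
      rw [Derivation.leibniz, vect_apply hD (pd K N i f), smul_eq_mul, smul_eq_mul, Finset.mul_sum,
        add_comm, mul_comm]
      simp only [mul_assoc]
    rw [h1, Finset.sum_involution (fun p _ => (p.2, p.1)), add_zero]
    · intro p _
      rw [pd_comm p.1 p.2, mul_comm (D (z K N p.2))]
      exact add_self K _
    · intro p _ hp e
      have e' : p.2 = p.1 := congrArg Prod.fst e
      rw [e'] at hp
      rcases h p.1 with h | h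
      · exact hp (by rw [h, zero_mul])
      · exact hp (by rw [pd_pd_of_one p.1 h, mul_zero])
    · intro p _; exact Finset.mem_univ _
    · intro p _; rfl
  · rw [derSq_apply, add_assoc]
    exact apply_mem_homog hD (hD.2 i)

theorem eq_zero_of_homog {w : κ → M} {d e : M} (h : d ≠ e) {f : truncated K N}
    (hf : f ∈ homog K N w d) (hf' : f ∈ homog K N w e) : f = 0 := by
  refine Subtype.ext (DPoly.ext fun r => ?_)
  by_contra hc
  exact h ((hf r hc).symm.trans (hf' r hc))

theorem eq_zero_of_vect {w : κ → M} {d e : M} (h : d ≠ e) {D : Der K N}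
    (hD : D ∈ vect K N w d) (hD' : D ∈ vect K N w e) : D = 0 := by
  rw [hD.1]
  refine Finset.sum_eq_zero fun i _ => ?_
  rw [eq_zero_of_homog (by simpa using h) (hD.2 i) (hD'.2 i), zero_smul]

variable (K N) in
/-- The vector fields of degree `d`, where `deg z_i = 1` and `deg ∂_i = -1`. -/
abbrev vectDeg (d : ℤ) : Submodule K (Der K N) := vect K N (fun _ => (1 : ℤ)) d

theorem vectDeg_eq_zero {d : ℤ} (hd : d + 1 < 0) {D : Der K N} (hD : D ∈ vectDeg K N d) :
    D = 0 := by
  rw [hD.1]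
  refine Finset.sum_eq_zero fun i _ => ?_
  suffices D (z K N i) = 0 by rw [this, zero_smul]
  refine Subtype.ext (DPoly.ext fun r => ?_)
  by_contra hc
  have h : ∑ j, r j • (1 : ℤ) = d + 1 := hD.2 i r hc
  have h' : 0 ≤ ∑ j, r j • (1 : ℤ) := Finset.sum_nonneg fun j _ => by simp
  omega

theorem eq_smul_one_of_homog {f : truncated K N} (hf : f ∈ homog K N (fun _ => (1 : ℤ)) 0) :
    f = coeff 0 f.1 • (1 : truncated K N) := by
  refine Subtype.ext (DPoly.ext fun r => ?_)
  change coeff r f.1 = coeff r (coeff 0 f.1 • mono 0 1)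
  rw [map_smul]
  by_cases hr : r = 0
  · subst hr; rw [coeff_mono_same, smul_eq_mul, mul_one]
  · rw [coeff_mono_ne hr, smul_zero]
    by_contra hc
    have h : ∑ j, r j • (1 : ℤ) = 0 := hf r hc
    rw [Finset.sum_eq_zero_iff_of_nonneg (fun j _ => by simp)] at h
    exact hr (funext fun j => by simpa using h j (Finset.mem_univ j))

theorem vectDeg_neg_one {D : Der K N} (hD : D ∈ vectDeg K N (-1)) :
    D = ∑ i, coeff 0 (D (z K N i)).1 • pd K N i := by
  conv_lhs => rw [hD.1]
  refine Finset.sum_congr rfl fun i _ => ?_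
  conv_lhs => rw [eq_smul_one_of_homog (f := D (z K N i)) (by simpa using hD.2 i)]
  rw [smul_assoc, one_smul]

end VectorFields

/-! ## Cartan prolongation -/

section Prolongation

variable {K : Type*} [Field K] [CharP K 2] {κ : Type*} [Fintype κ] [DecidableEq κ]
  {N : κ → WithTop ℕ+}

/-- The homogeneous components of the Cartan prolong with `0`-th component `G` in the vector fields
with divided power coefficients and shearing vector `N`. The component of degree `k ≥ -1` is
`prolong G (k + 1)`: it consists of all constant fields for `k = -1`, it is `G` for `k = 0`, and for
`k > 0` it consists of the vector fields `D` of degree `k` such that all the `[D, ∂_i]` lie in the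
component of degree `k - 1`. -/
def prolong (G : Submodule K (Der K N)) : ℕ → Submodule K (Der K N)
  | 0 => vectDeg K N (-1)
  | 1 => G
  | n + 2 =>
    { carrier := {D | D ∈ vectDeg K N (n + 1) ∧ ∀ i, ⁅D, pd K N i⁆ ∈ prolong G (n + 1)}
      zero_mem' := ⟨zero_mem _, fun i => by rw [zero_der_lie]; exact zero_mem _⟩
      add_mem' := fun hD hE => ⟨add_mem hD.1 hE.1, fun i => by
        rw [add_der_lie]; exact add_mem (hD.2 i) (hE.2 i)⟩
      smul_mem' := fun c D hD => ⟨Submodule.smul_mem _ c hD.1, fun i => by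
        rw [smul_der_lie]; exact Submodule.smul_mem _ c (hD.2 i)⟩ }

variable {G : Submodule K (Der K N)}

theorem mem_prolong_add_two {n : ℕ} {D : Der K N} : D ∈ prolong G (n + 2) ↔
    D ∈ vectDeg K N (n + 1) ∧ ∀ i, ⁅D, pd K N i⁆ ∈ prolong G (n + 1) := Iff.rfl

theorem prolong_le (hG : G ≤ vectDeg K N 0) (n : ℕ) {D : Der K N} (hD : D ∈ prolong G n) :
    D ∈ vectDeg K N (n - 1) := by
  match n, hD with
  | 0, hD => exact hD
  | 1, hD => exact hG hD
  | n + 2, hD =>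
    have := hD.1
    rwa [show ((n + 2 : ℕ) : ℤ) - 1 = n + 1 by push_cast; ring]

theorem prolong_lie_pd (hG : G ≤ vectDeg K N 0) (n : ℕ) {D : Der K N}
    (hD : D ∈ prolong G (n + 1)) (i : κ) : ⁅D, pd K N i⁆ ∈ prolong G n := by
  match n, hD with
  | 0, hD =>
    have := lie_mem_vect (hG hD) (pd_mem_vect (fun _ => (1 : ℤ)) i)
    rwa [zero_add] at this
  | n + 1, hD => exact hD.2 i

theorem prolong_lie_const (hG : G ≤ vectDeg K N 0) (n : ℕ) {D E : Der K N}
    (hD : D ∈ prolong G (n + 1)) (hE : E ∈ prolong G 0) : ⁅D, E⁆ ∈ prolong G n := by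
  rw [vectDeg_neg_one hE, der_lie_sum]
  refine sum_mem fun i _ => ?_
  rw [der_lie_smul]
  exact Submodule.smul_mem _ _ (prolong_lie_pd hG n hD i)

theorem prolong_lie (hG : G ≤ vectDeg K N 0) (hl : ∀ D ∈ G, ∀ E ∈ G, ⁅D, E⁆ ∈ G) (s : ℕ) :
    ∀ (m n : ℕ), m + n = s + 1 → ∀ D ∈ prolong G m, ∀ E ∈ prolong G n, ⁅D, E⁆ ∈ prolong G s := by
  induction s with
  | zero =>
    intro m n h D hD E hE
    rcases m with _ | m
    · obtain rfl : n = 0 + 1 := by omega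
      rw [← lie_skew]
      exact neg_mem (prolong_lie_const hG 0 hE hD)
    · obtain ⟨rfl, rfl⟩ : m = 0 ∧ n = 0 := by omega
      exact prolong_lie_const hG 0 hD hE
  | succ s ih =>
    intro m n h D hD E hE
    rcases m with _ | m
    · obtain rfl : n = s + 1 + 1 := by omega
      rw [← lie_skew]
      exact neg_mem (prolong_lie_const hG _ hE hD)
    rcases n with _ | n
    · obtain rfl : m = s + 1 := by omega
      exact prolong_lie_const hG _ hD hE
    rcases s with _ | s
    · obtain ⟨rfl, rfl⟩ : m = 0 ∧ n = 0 := by omega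
      exact hl D hD E hE
    · refine ⟨?_, fun i => ?_⟩
      · have := lie_mem_vect (prolong_le hG _ hD) (prolong_le hG _ hE)
        rwa [show ((m + 1 : ℕ) : ℤ) - 1 + (((n + 1 : ℕ) : ℤ) - 1) = s + 1 by omega] at this
      · rw [der_lie_lie]
        refine sub_mem ?_ ?_
        · exact ih (m + 1) n (by omega) D hD _ (prolong_lie_pd hG n hE i)
        · exact ih (n + 1) m (by omega) E hE _ (prolong_lie_pd hG m hD i)

theorem prolong_lie_zero {D E : Der K N} (hD : D ∈ prolong G 0) (hE : E ∈ prolong G 0) :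
    ⁅D, E⁆ = 0 :=
  vectDeg_eq_zero (by norm_num) (lie_mem_vect hD hE)

theorem prolong_sq (hG : G ≤ vectDeg K N 0) (hl : ∀ D ∈ G, ∀ E ∈ G, ⁅D, E⁆ ∈ G) (n : ℕ)
    {D : Der K N} (hD : D ∈ prolong G (n + 1)) (h1 : D ∈ G → derSq D ∈ G)
    (h2 : ∀ i, D (z K N i) * D (z K N i) = 0 ∨ N i = 1) : derSq D ∈ prolong G (2 * n + 1) := by
  rcases n with _ | n
  · exact h1 hD
  · rw [show 2 * (n + 1) + 1 = 2 * n + 1 + 2 by ring, mem_prolong_add_two]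
    refine ⟨?_, fun i => ?_⟩
    · have := derSq_mem_vect (prolong_le hG _ hD) h2
      rwa [show ((n + 1 + 1 : ℕ) : ℤ) - 1 + (((n + 1 + 1 : ℕ) : ℤ) - 1) =
        ((2 * n + 1 : ℕ) : ℤ) + 1 by push_cast; ring] at this
    · rw [derSq_lie]
      exact prolong_lie hG hl _ (n + 2) (n + 1) (by omega) D hD _ (prolong_lie_pd hG _ hD i)

theorem prolong_sq_zero {D : Der K N} (hD : D ∈ prolong G 0)
    (h2 : ∀ i, D (z K N i) * D (z K N i) = 0 ∨ N i = 1) : derSq D = 0 :=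
  vectDeg_eq_zero (by norm_num) (derSq_mem_vect hD h2)

/-! ### Linear and constant vector fields -/

variable {W : Type*} [AddCommGroup W] [Module K W] (B : Module.Basis κ K W)

variable (N) in
/-- The constant vector field `∑ v_j ∂_j`, which represents the vector `v` with coordinates
`v_j`. -/
def constField : W →ₗ[K] Der K N where
  toFun := fun v => ∑ j, B.repr v j • pd K N j
  map_add' := fun v v' => by simp [add_smul, Finset.sum_add_distrib]
  map_smul' := fun c v => by simp [mul_smul, Finset.smul_sum]

variable (N) in
/-- The linear vector field `∑ A_{ji} z_i ∂_j`, which represents the operator `A` with matrix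
`A_{ji}`: in characteristic `2`, its bracket with the constant field of `v` is the constant field
of `A v`. -/
def linField : (W →ₗ[K] W) →ₗ[K] Der K N where
  toFun := fun A => ∑ j, (∑ i, B.repr (A (B i)) j • z K N i) • pd K N j
  map_add' := fun A A' => by simp [add_smul, Finset.sum_add_distrib]
  map_smul' := fun c A => by simp [mul_smul, Finset.smul_sum, Finset.sum_smul, smul_assoc]

theorem constField_mem (v : W) : constField N B v ∈ vectDeg K N (-1) :=
  sum_mem fun j _ => Submodule.smul_mem _ _ (pd_mem_vect (fun _ => (1 : ℤ)) j)

theorem linField_z (A : W →ₗ[K] W) (k : κ) :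
    linField N B A (z K N k) = ∑ i, B.repr (A (B i)) k • z K N i := by
  simp [linField, der_sum_apply, pd_z]

theorem linField_apply (A : W →ₗ[K] W) (f : truncated K N) :
    linField N B A f = ∑ k, linField N B A (z K N k) * pd K N k f := by
  simp only [linField_z]
  simp [linField, der_sum_apply]

theorem linField_mem {M : Type*} [AddCommGroup M] {w : κ → M} {d : M} (A : W →ₗ[K] W)
    (h : ∀ i k, B.repr (A (B i)) k ≠ 0 → w i = d + w k) : linField N B A ∈ vect K N w d := by
  refine vect_of_apply (linField_apply B A) fun k => ?_
  rw [linField_z]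
  refine sum_mem fun i _ => ?_
  by_cases hc : B.repr (A (B i)) k = 0
  · rw [hc, zero_smul]; exact zero_mem _
  · refine Submodule.smul_mem _ _ ?_
    rw [← h i k hc]
    exact z_mem_homog w i

theorem linField_mem_zero (A : W →ₗ[K] W) : linField N B A ∈ vectDeg K N 0 :=
  linField_mem B A fun _ _ _ => by simp

theorem linField_linField_z (A A' : W →ₗ[K] W) (k : κ) :
    linField N B A (linField N B A' (z K N k)) = linField N B (A' ∘ₗ A) (z K N k) := by
  simp only [linField_z, map_sum, Derivation.map_smul, Finset.smul_sum]
  rw [Finset.sum_comm]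
  refine Finset.sum_congr rfl fun i _ => ?_
  rw [← Finset.sum_congr rfl fun j _ => (smul_smul (B.repr (A' (B j)) k) (B.repr (A (B i)) j) _).symm,
    ← Finset.sum_smul]
  congr 1
  have h : A (B i) = ∑ j, B.repr (A (B i)) j • B j := (B.sum_repr _).symm
  rw [LinearMap.comp_apply]
  conv_rhs => rw [h]
  simp only [map_sum, map_smul, Finsupp.coe_finsetSum, Finset.sum_apply, Finsupp.smul_apply,
    smul_eq_mul]
  exact Finset.sum_congr rfl fun j _ => mul_comm _ _

theorem linField_lie (A A' : W →ₗ[K] W) :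
    ⁅linField N B A, linField N B A'⁆ = linField N B (A ∘ₗ A' - A' ∘ₗ A) := by
  refine vect_ext (lie_mem_vect (linField_mem_zero B A) (linField_mem_zero B A'))
    (linField_mem_zero B _) fun k => ?_
  rw [Derivation.commutator_apply, linField_linField_z, linField_linField_z, map_sub,
    Derivation.sub_apply, sub_self_add K, sub_self_add K, add_comm]

theorem derSq_linField (A : W →ₗ[K] W)
    (h : ∀ i, linField N B A (z K N i) * linField N B A (z K N i) = 0 ∨ N i = 1) :
    derSq (linField N B A) = linField N B (A ∘ₗ A) :=
  vect_ext (derSq_mem_vect (linField_mem_zero B A) h) (linField_mem_zero B _) fun k => by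
    rw [derSq_apply, linField_linField_z]

/-! ### Sums of homogeneous components -/

theorem lie_mem_iSup {Q Q' Q'' : ℕ → Submodule K (Der K N)}
    (h : ∀ m n, ∀ D ∈ Q m, ∀ E ∈ Q' n, ⁅D, E⁆ ∈ ⨆ k, Q'' k) {D E : Der K N}
    (hD : D ∈ ⨆ k, Q k) (hE : E ∈ ⨆ k, Q' k) : ⁅D, E⁆ ∈ ⨆ k, Q'' k := by
  refine Submodule.iSup_induction Q (motive := fun D => ⁅D, E⁆ ∈ ⨆ k, Q'' k) hD ?_ ?_ ?_
  · intro m D hD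
    refine Submodule.iSup_induction Q' (motive := fun E => ⁅D, E⁆ ∈ ⨆ k, Q'' k) hE ?_ ?_ ?_
    · exact fun n E hE => h m n D hD E hE
    · rw [der_lie_zero]; exact zero_mem _
    · intro E E' h1 h2; rw [der_lie_add]; exact add_mem h1 h2
  · rw [zero_der_lie]; exact zero_mem _
  · intro D D' h1 h2; rw [add_der_lie]; exact add_mem h1 h2

theorem derSq_mem_iSup {Q Q' : ℕ → Submodule K (Der K N)}
    (h : ∀ m n, ∀ D ∈ Q m, ∀ E ∈ Q n, ⁅D, E⁆ ∈ ⨆ k, Q' k)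
    (h' : ∀ n, ∀ D ∈ Q n, derSq D ∈ ⨆ k, Q' k) {D : Der K N}
    (hD : D ∈ ⨆ k, Q k) : derSq D ∈ ⨆ k, Q' k := by
  have key : D ∈ ⨆ k, Q k ∧ derSq D ∈ ⨆ k, Q' k := by
    refine Submodule.iSup_induction Q
      (motive := fun D => D ∈ ⨆ k, Q k ∧ derSq D ∈ ⨆ k, Q' k) hD ?_ ?_ ?_
    · exact fun n D hD => ⟨Submodule.mem_iSup_of_mem n hD, h' n D hD⟩
    · refine ⟨zero_mem _, ?_⟩
      have : derSq (0 : Der K N) = 0 := by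
        have := derSq_smul (0 : K) (0 : Der K N); simpa using this
      rw [this]; exact zero_mem _
    · intro D D' h1 h2
      refine ⟨add_mem h1.1 h2.1, ?_⟩
      rw [derSq_add]
      exact add_mem (add_mem h1.2 h2.2) (lie_mem_iSup h h1.1 h2.1)
  exact key.2

theorem prolong_graded_lie (hG : G ≤ vectDeg K N 0) (hl : ∀ D ∈ G, ∀ E ∈ G, ⁅D, E⁆ ∈ G)
    {P : Submodule K (Der K N)} (m n : ℕ) {D E : Der K N} (hD : D ∈ prolong G m)
    (hE : E ∈ prolong G n) (hP : ⁅D, E⁆ ∈ P) : ⁅D, E⁆ ∈ ⨆ k, prolong G k ⊓ P := by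
  rcases h : m + n with _ | s
  · obtain ⟨rfl, rfl⟩ : m = 0 ∧ n = 0 := by omega
    rw [prolong_lie_zero hD hE]; exact zero_mem _
  · exact Submodule.mem_iSup_of_mem s ⟨prolong_lie hG hl s m n h D hD E hE, hP⟩

theorem prolong_graded_sq (hG : G ≤ vectDeg K N 0) (hl : ∀ D ∈ G, ∀ E ∈ G, ⁅D, E⁆ ∈ G)
    {P : Submodule K (Der K N)} (n : ℕ) {D : Der K N} (hD : D ∈ prolong G n)
    (h1 : D ∈ G → derSq D ∈ G) (h2 : ∀ i, D (z K N i) * D (z K N i) = 0 ∨ N i = 1)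
    (hP : derSq D ∈ P) : derSq D ∈ ⨆ k, prolong G k ⊓ P := by
  rcases n with _ | n
  · rw [prolong_sq_zero hD h2]; exact zero_mem _
  · exact Submodule.mem_iSup_of_mem _ ⟨prolong_sq hG hl n hD h1 h2, hP⟩

end Prolongation

/-! ## The Cartan prolong of a Lie algebra and its module -/

section Cartan

variable {K : Type*} [Field K] [CharP K 2] (L : Type*) [LieRing L] [LieAlgebra K L]
  {V : Type*} [AddCommGroup V] [Module K V] [LieRingModule L V] [LieModule K L V]
  {ι : Type*} [Fintype ι] [DecidableEq ι] (b : Module.Basis ι K V)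

/-- The shearing vector `N_s = (1, …, 1)`. -/
def shearOne (ι : Type*) : ι → WithTop ℕ+ := fun _ => 1

/-- The representation of `L` in `V` by linear vector fields. -/
def actField : L →ₗ[K] Der K (shearOne ι) :=
  linField (shearOne ι) b ∘ₗ (LieModule.toEnd K L V : L →ₗ[K] V →ₗ[K] V)

/-- The component of degree `n - 1` of the Cartan prolong `(V, L)_{*, N_s}`. -/
def cartanComponent (n : ℕ) : Submodule K (Der K (shearOne ι)) :=
  prolong (LinearMap.range (actField L b)) n

theorem actField_le : LinearMap.range (actField L b) ≤ vectDeg K (shearOne ι) 0 := by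
  rintro _ ⟨x, rfl⟩
  exact linField_mem_zero b _

theorem actField_lie (x y : L) : ⁅actField L b x, actField L b y⁆ = actField L b ⁅x, y⁆ := by
  refine (linField_lie b _ _).trans (congrArg (linField (shearOne ι) b) ?_)
  ext v
  simp

theorem actField_closed : ∀ D ∈ LinearMap.range (actField L b),
    ∀ E ∈ LinearMap.range (actField L b), ⁅D, E⁆ ∈ LinearMap.range (actField L b) := by
  rintro _ ⟨x, rfl⟩ _ ⟨y, rfl⟩
  exact ⟨⁅x, y⁆, (actField_lie L b x y).symm⟩

theorem cartan_lie (m n : ℕ) : ∀ D ∈ cartanComponent L b m, ∀ E ∈ cartanComponent L b n,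
    ⁅D, E⁆ ∈ ⨆ k, cartanComponent L b k := fun D hD E hE => by
  have := prolong_graded_lie (actField_le L b) (actField_closed L b) (P := ⊤) m n hD hE trivial
  simp only [inf_top_eq] at this
  exact this

/-- The Cartan prolong `(V, L)_{*, N_s}`, the direct sum of its components, in the Lie algebra of
vector fields on `V` with coefficients in the divided powers with shearing vector `N_s`. -/
def CartanProlong : LieSubalgebra K (Der K (shearOne ι)) where
  __ := ⨆ n, cartanComponent L b n
  lie_mem' := fun hD hE => lie_mem_iSup (cartan_lie L b) hD hE

theorem actField_sq [TwoStructure K L] [IsRestrictedModule K L V] (x : L) :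
    derSq (actField L b x) = actField L b (TwoStructure.sq K x) := by
  refine (derSq_linField b _ fun _ => Or.inr rfl).trans (congrArg (linField (shearOne ι) b) ?_)
  ext v
  exact (IsRestrictedModule.sq_lie (K := K) x v).symm

theorem cartan_sq [TwoStructure K L] [IsRestrictedModule K L V] {D : Der K (shearOne ι)}
    (hD : D ∈ CartanProlong L b) : derSq D ∈ CartanProlong L b := by
  refine derSq_mem_iSup (cartan_lie L b) (fun n D hD => ?_) hD
  have := prolong_graded_sq (actField_le L b) (actField_closed L b) (P := ⊤) n hD ?_
    (fun _ => Or.inr rfl) trivial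
  · simp only [inf_top_eq] at this
    exact this
  · rintro ⟨x, rfl⟩
    exact ⟨_, (actField_sq L b x).symm⟩

/-- The `2`-structure of the Cartan prolong: the composition square of derivations. -/
instance [TwoStructure K L] [IsRestrictedModule K L V] : TwoStructure K (CartanProlong L b) where
  sq := fun D => ⟨derSq D.1, cartan_sq L b D.2⟩
  sq_lie := fun D E => Subtype.ext (derSq_lie D.1 E.1)
  sq_smul := fun a D => Subtype.ext (derSq_smul a D.1)
  sq_add := fun D E => Subtype.ext (derSq_add D.1 E.1)

/-- The component of degree `-1` of the Cartan prolong, as a copy of `V`. -/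
def CartanProlong.ofModule (v : V) : CartanProlong L b :=
  ⟨constField (shearOne ι) b v,
    Submodule.mem_iSup_of_mem (p := cartanComponent L b) 0 (constField_mem b v)⟩

/-- The map from `L` to the component of degree `0` of the Cartan prolong. -/
def CartanProlong.ofLie (x : L) : CartanProlong L b :=
  ⟨actField L b x, Submodule.mem_iSup_of_mem (p := cartanComponent L b) 1 ⟨x, rfl⟩⟩

end Cartan

/-! ## The Cartan prolong of a Lie superalgebra and its module -/

section Super

variable {K : Type*} [Field K] [CharP K 2] (E F : Type*) {V₀ V₁ : Type*} [LieRing E]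
  [LieAlgebra K E] [AddCommGroup F] [Module K F] [LieRingModule E F] [LieModule K E F]
  [LieSuperalgebraTwo K E F]
  [AddCommGroup V₀] [Module K V₀] [LieRingModule E V₀] [LieModule K E V₀]
  [AddCommGroup V₁] [Module K V₁] [LieRingModule E V₁] [LieModule K E V₁]
  [LieSupermoduleTwo K E F V₀ V₁]
  {ι κ : Type*} [Fintype ι] [DecidableEq ι] [Fintype κ] [DecidableEq κ]
  (b₀ : Module.Basis ι K V₀) (b₁ : Module.Basis κ K V₁) (N : ι → WithTop ℕ+)

/-- The action of an even element on `V₀ ⊕ V₁`. -/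
def evenOp : E →ₗ[K] (V₀ × V₁) →ₗ[K] (V₀ × V₁) where
  toFun := fun e => (LieModule.toEnd K E V₀ e).prodMap (LieModule.toEnd K E V₁ e)
  map_add' := fun e e' => by ext <;> simp
  map_smul' := fun c e => by ext <;> simp

/-- The action of an odd element on `V₀ ⊕ V₁`. -/
def oddOp : F →ₗ[K] (V₀ × V₁) →ₗ[K] (V₀ × V₁) where
  toFun := fun x =>
    ((LieSupermoduleTwo.act₁ E x : V₁ →ₗ[K] V₀) ∘ₗ LinearMap.snd K V₀ V₁).prod
      ((LieSupermoduleTwo.act₀ E x : V₀ →ₗ[K] V₁) ∘ₗ LinearMap.fst K V₀ V₁)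
  map_add' := fun e e' => by ext <;> simp
  map_smul' := fun c e => by ext <;> simp

/-- The shearing vector for even indeterminates `z_i`, `i ∈ ι`, with shearing vector `N`, and odd
indeterminates `ξ_j`, `j ∈ κ`. -/
def superShear (κ : Type*) (N : ι → WithTop ℕ+) : ι ⊕ κ → WithTop ℕ+ := Sum.elim N fun _ => 1

/-- The parity of the even indeterminates `z_i`, `i ∈ ι`, and the odd indeterminates `ξ_j`,
`j ∈ κ`. -/
def parity (ι κ : Type*) : ι ⊕ κ → ZMod 2 := Sum.elim (fun _ => 0) fun _ => 1

/-- The vector fields of parity `ε`. -/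
def vectParity (ε : ZMod 2) : Submodule K (Der K (superShear κ N)) :=
  vect K (superShear κ N) (parity ι κ) ε

/-- The representation of `E` in `V₀ ⊕ V₁` by linear vector fields. -/
def evenField : E →ₗ[K] Der K (superShear κ N) :=
  linField (superShear κ N) (b₀.prod b₁) ∘ₗ evenOp E

/-- The representation of `F` in `V₀ ⊕ V₁` by linear vector fields. -/
def oddField : F →ₗ[K] Der K (superShear κ N) :=
  linField (superShear κ N) (b₀.prod b₁) ∘ₗ oddOp E F

/-- The linear vector fields that represent the elements of `E ⊕ F`. -/
def actRange : Submodule K (Der K (superShear κ N)) :=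
  LinearMap.range (evenField E b₀ b₁ N) ⊔ LinearMap.range (oddField E F b₀ b₁ N)

/-- The component of degree `n - 1` of the Cartan prolong `(V₀ ⊕ V₁, E ⊕ F)_{*, N}`. -/
def superComponent (n : ℕ) : Submodule K (Der K (superShear κ N)) :=
  prolong (actRange E F b₀ b₁ N) n

theorem actRange_le : actRange E F b₀ b₁ N ≤ vectDeg K (superShear κ N) 0 := by
  refine sup_le ?_ ?_
  · rintro _ ⟨x, rfl⟩
    exact linField_mem_zero _ _
  · rintro _ ⟨x, rfl⟩
    exact linField_mem_zero _ _

theorem evenField_parity (e : E) : evenField E b₀ b₁ N e ∈ vectParity (κ := κ) N 0 := by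
  refine linField_mem _ _ fun i k h => ?_
  rcases i with i | i <;> rcases k with k | k
  · simp [parity]
  · exact absurd (by simp [evenOp]) h
  · exact absurd (by simp [evenOp]) h
  · simp [parity]

theorem oddField_parity (x : F) : oddField E F b₀ b₁ N x ∈ vectParity (κ := κ) N 1 := by
  refine linField_mem _ _ fun i k h => ?_
  rcases i with i | i <;> rcases k with k | k
  · exact absurd (by simp [oddOp]) h
  · simp only [parity, Sum.elim_inl, Sum.elim_inr]; decide
  · simp [parity]
  · exact absurd (by simp [oddOp]) h

theorem evenField_lie (e e' : E) :
    ⁅evenField E b₀ b₁ N e, evenField E b₀ b₁ N e'⁆ = evenField E b₀ b₁ N ⁅e, e'⁆ := by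
  refine (linField_lie _ _ _).trans (congrArg (linField (superShear κ N) (b₀.prod b₁)) ?_)
  ext <;> simp [evenOp]

theorem evenField_oddField_lie (e : E) (x : F) :
    ⁅evenField E b₀ b₁ N e, oddField E F b₀ b₁ N x⁆ = oddField E F b₀ b₁ N ⁅e, x⁆ := by
  refine (linField_lie _ _ _).trans (congrArg (linField (superShear κ N) (b₀.prod b₁)) ?_)
  ext <;> simp [evenOp, oddOp, LieSupermoduleTwo.lie_act₀, LieSupermoduleTwo.lie_act₁]

theorem oddOp_comp_self (x : F) :
    (oddOp (K := K) (V₀ := V₀) (V₁ := V₁) E F x) ∘ₗ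
      (oddOp (K := K) (V₀ := V₀) (V₁ := V₁) E F x) =
    evenOp (K := K) E (LieSuperalgebraTwo.sq K x : E) := by
  have h₀ := LieSupermoduleTwo.sq_act₀ (K := K) (E := E) (V₀ := V₀) (V₁ := V₁) x
  have h₁ := LieSupermoduleTwo.sq_act₁ (K := K) (E := E) (V₀ := V₀) (V₁ := V₁) x
  ext <;> simp [evenOp, oddOp, h₀, h₁]

theorem oddField_lie (x y : F) : ⁅oddField E F b₀ b₁ N x, oddField E F b₀ b₁ N y⁆ =
    evenField E b₀ b₁ N (LieSuperalgebraTwo.bracket (K := K) x y) := by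
  refine (linField_lie _ _ _).trans (congrArg (linField (superShear κ N) (b₀.prod b₁)) ?_)
  have h := oddOp_comp_self (K := K) (V₀ := V₀) (V₁ := V₁) E F (x + y)
  rw [LieSuperalgebraTwo.sq_add, map_add, map_add, map_add, LinearMap.add_comp,
    LinearMap.comp_add, LinearMap.comp_add, oddOp_comp_self, oddOp_comp_self] at h
  rw [sub_self_add K]
  have h' := congrArg (fun A => A -
    (evenOp (K := K) (V₀ := V₀) (V₁ := V₁) E (LieSuperalgebraTwo.sq K x : E) +
      evenOp (K := K) E (LieSuperalgebraTwo.sq K y : E))) h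
  rw [add_sub_cancel_left] at h'
  rw [← h']
  abel

theorem actRange_closed : ∀ D ∈ actRange E F b₀ b₁ N,
    ∀ D' ∈ actRange E F b₀ b₁ N, ⁅D, D'⁆ ∈ actRange E F b₀ b₁ N := by
  intro D hD D' hD'
  obtain ⟨_, ⟨e, rfl⟩, _, ⟨x, rfl⟩, rfl⟩ := Submodule.mem_sup.1 hD
  obtain ⟨_, ⟨e', rfl⟩, _, ⟨x', rfl⟩, rfl⟩ := Submodule.mem_sup.1 hD'
  have hE : ∀ e, evenField E b₀ b₁ N e ∈ actRange E F b₀ b₁ N := fun e =>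
    Submodule.mem_sup_left ⟨e, rfl⟩
  have hF : ∀ x, oddField E F b₀ b₁ N x ∈ actRange E F b₀ b₁ N := fun x =>
    Submodule.mem_sup_right ⟨x, rfl⟩
  rw [add_der_lie, der_lie_add, der_lie_add, evenField_lie, evenField_oddField_lie, oddField_lie,
    ← lie_skew (oddField E F b₀ b₁ N x), evenField_oddField_lie]
  exact add_mem (add_mem (hE _) (hF _)) (add_mem (neg_mem (hF _)) (hE _))

theorem oddField_sq_cond {D : Der K (superShear κ N)} (hD : D ∈ vectParity (κ := κ) N 1)
    (i : ι ⊕ κ) : D (z K _ i) * D (z K _ i) = 0 ∨ superShear κ N i = 1 := by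
  rcases i with i | i
  · left
    exact mul_self_eq_zero_of_homog (by simp [parity]) (hD.2 (Sum.inl i))
  · exact Or.inr rfl

theorem actRange_sq {D : Der K (superShear κ N)} (hD : D ∈ vectParity (κ := κ) N 1)
    (h : D ∈ actRange E F b₀ b₁ N) : derSq D ∈ actRange E F b₀ b₁ N := by
  obtain ⟨_, ⟨e, rfl⟩, _, ⟨x, rfl⟩, rfl⟩ := Submodule.mem_sup.1 h
  have h0 : evenField E b₀ b₁ N e = 0 := by
    refine eq_zero_of_vect (d := (0 : ZMod 2)) (e := 1) (by decide)
      (evenField_parity E b₀ b₁ N e) ?_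
    have := sub_mem hD (oddField_parity E F b₀ b₁ N x)
    rwa [add_sub_cancel_right] at this
  rw [h0, zero_add] at hD ⊢
  refine Submodule.mem_sup_left ⟨LieSuperalgebraTwo.sq K x, ?_⟩
  refine Eq.trans ?_ (derSq_linField _ _ (oddField_sq_cond N hD)).symm
  rw [oddOp_comp_self]
  rfl

theorem super_lie (ε ε' : ZMod 2) (m n : ℕ) :
    ∀ D ∈ superComponent E F b₀ b₁ N m ⊓ vectParity N ε,
    ∀ D' ∈ superComponent E F b₀ b₁ N n ⊓ vectParity N ε',
    ⁅D, D'⁆ ∈ ⨆ k, superComponent E F b₀ b₁ N k ⊓ vectParity N (ε + ε') := fun _ hD _ hD' =>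
  prolong_graded_lie (actRange_le E F b₀ b₁ N) (actRange_closed E F b₀ b₁ N) m n hD.1 hD'.1
    (lie_mem_vect hD.2 hD'.2)

/-- The even part of the Cartan prolong `(V₀ ⊕ V₁, E ⊕ F)_{*, N}`. -/
def SuperProlongEven : LieSubalgebra K (Der K (superShear κ N)) where
  __ := ⨆ n, superComponent E F b₀ b₁ N n ⊓ vectParity N 0
  lie_mem' := fun hD hE => lie_mem_iSup (super_lie E F b₀ b₁ N 0 0) hD hE

/-- The odd part of the Cartan prolong `(V₀ ⊕ V₁, E ⊕ F)_{*, N}`. -/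
def SuperProlongOdd : Submodule K (Der K (superShear κ N)) :=
  ⨆ n, superComponent E F b₀ b₁ N n ⊓ vectParity N 1

theorem super_lie_even_odd {D D' : Der K (superShear κ N)} (hD : D ∈ SuperProlongEven E F b₀ b₁ N)
    (hD' : D' ∈ SuperProlongOdd E F b₀ b₁ N) : ⁅D, D'⁆ ∈ SuperProlongOdd E F b₀ b₁ N := by
  have := lie_mem_iSup (super_lie E F b₀ b₁ N 0 1) hD hD'
  rwa [zero_add] at this

theorem super_lie_odd_odd {D D' : Der K (superShear κ N)} (hD : D ∈ SuperProlongOdd E F b₀ b₁ N)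
    (hD' : D' ∈ SuperProlongOdd E F b₀ b₁ N) : ⁅D, D'⁆ ∈ SuperProlongEven E F b₀ b₁ N :=
  lie_mem_iSup (super_lie E F b₀ b₁ N 1 1) hD hD'

theorem super_sq {D : Der K (superShear κ N)} (hD : D ∈ SuperProlongOdd E F b₀ b₁ N) :
    derSq D ∈ SuperProlongEven E F b₀ b₁ N :=
  derSq_mem_iSup (super_lie E F b₀ b₁ N 1 1) (fun n _ hD =>
    prolong_graded_sq (actRange_le E F b₀ b₁ N) (actRange_closed E F b₀ b₁ N) n hD.1
      (actRange_sq E F b₀ b₁ N hD.2) (oddField_sq_cond N hD.2)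
      (derSq_mem_vect hD.2 (oddField_sq_cond N hD.2))) hD

instance : LieRingModule (SuperProlongEven E F b₀ b₁ N) (SuperProlongOdd E F b₀ b₁ N) where
  bracket := fun D D' => ⟨⁅D.1, D'.1⁆, super_lie_even_odd E F b₀ b₁ N D.2 D'.2⟩
  add_lie := fun D D' D'' => Subtype.ext (add_der_lie D.1 D'.1 D''.1)
  lie_add := fun D D' D'' => Subtype.ext (der_lie_add D.1 D'.1 D''.1)
  leibniz_lie := fun D D' D'' => Subtype.ext (der_leibniz_lie D.1 D'.1 D''.1)

instance : LieModule K (SuperProlongEven E F b₀ b₁ N) (SuperProlongOdd E F b₀ b₁ N) where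
  smul_lie := fun c D D' => Subtype.ext (smul_der_lie c D.1 D'.1)
  lie_smul := fun c D D' => Subtype.ext (der_lie_smul c D.1 D'.1)

/-- The Cartan prolong `(V₀ ⊕ V₁, E ⊕ F)_{*, N}` as a Lie superalgebra: the bracket is the
commutator, the square of an odd vector field is its composition square. -/
instance superProlong :
    LieSuperalgebraTwo K (SuperProlongEven E F b₀ b₁ N) (SuperProlongOdd E F b₀ b₁ N) where
  sq := fun D => ⟨derSq D.1, super_sq E F b₀ b₁ N D.2⟩
  bracket := LinearMap.mk₂ K
    (fun D D' => ⟨⁅D.1, D'.1⁆, super_lie_odd_odd E F b₀ b₁ N D.2 D'.2⟩)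
    (fun D D' D'' => Subtype.ext (add_der_lie D.1 D'.1 D''.1))
    (fun c D D' => Subtype.ext (smul_der_lie c D.1 D'.1))
    (fun D D' D'' => Subtype.ext (der_lie_add D.1 D'.1 D''.1))
    (fun c D D' => Subtype.ext (der_lie_smul c D.1 D'.1))
  sq_smul := fun a D => Subtype.ext (derSq_smul a D.1)
  sq_add := fun D D' => Subtype.ext (derSq_add D.1 D'.1)
  sq_lie_even := fun D D' => Subtype.ext (by
    change ⁅derSq D.1, D'.1⁆ = ⁅D.1, ⁅D'.1, D.1⁆⁆
    rw [derSq_lie, ← lie_skew D.1 D'.1]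
    exact congrArg _ (neg_self K _))
  sq_lie_odd := fun D D' => Subtype.ext (by
    change ⁅derSq D.1, D'.1⁆ = ⁅⁅D.1, D'.1⁆, D.1⁆
    rw [derSq_lie, ← lie_skew D.1 ⁅D.1, D'.1⁆]
    exact neg_self K _)

theorem constField_even (v : V₀) :
    constField (superShear κ N) (b₀.prod b₁) (v, 0) ∈ vectParity (κ := κ) N 0 := by
  refine sum_mem fun j _ => ?_
  rcases j with j | j
  · refine Submodule.smul_mem _ _ ?_
    have := pd_mem_vect (K := K) (N := superShear κ N) (parity ι κ) (Sum.inl j)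
    rwa [show -parity ι κ (Sum.inl j) = 0 from neg_zero] at this
  · simp

theorem constField_odd (v : V₁) :
    constField (superShear κ N) (b₀.prod b₁) (0, v) ∈ vectParity (κ := κ) N 1 := by
  refine sum_mem fun j _ => ?_
  rcases j with j | j
  · simp
  · refine Submodule.smul_mem _ _ ?_
    have := pd_mem_vect (K := K) (N := superShear κ N) (parity ι κ) (Sum.inr j)
    rwa [show -parity ι κ (Sum.inr j) = 1 from rfl] at this

/-- The even part of the component of degree `-1`, as a copy of `V₀`. -/
def SuperProlongEven.ofModule (v : V₀) : SuperProlongEven E F b₀ b₁ N :=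
  ⟨constField (superShear κ N) (b₀.prod b₁) (v, 0),
    Submodule.mem_iSup_of_mem (p := fun n => superComponent E F b₀ b₁ N n ⊓ vectParity N 0) 0
      ⟨constField_mem _ _, constField_even b₀ b₁ N v⟩⟩

/-- The odd part of the component of degree `-1`, as a copy of `V₁`. -/
def SuperProlongOdd.ofModule (v : V₁) : SuperProlongOdd E F b₀ b₁ N :=
  ⟨constField (superShear κ N) (b₀.prod b₁) (0, v),
    Submodule.mem_iSup_of_mem (p := fun n => superComponent E F b₀ b₁ N n ⊓ vectParity N 1) 0
      ⟨constField_mem _ _, constField_odd b₀ b₁ N v⟩⟩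

/-- The map from `E` to the even part of the component of degree `0`. -/
def SuperProlongEven.ofLie (e : E) : SuperProlongEven E F b₀ b₁ N :=
  ⟨evenField E b₀ b₁ N e,
    Submodule.mem_iSup_of_mem (p := fun n => superComponent E F b₀ b₁ N n ⊓ vectParity N 0) 1
      ⟨Submodule.mem_sup_left ⟨e, rfl⟩, evenField_parity E b₀ b₁ N e⟩⟩

/-- The map from `F` to the odd part of the component of degree `0`. -/
def SuperProlongOdd.ofLie (x : F) : SuperProlongOdd E F b₀ b₁ N :=
  ⟨oddField E F b₀ b₁ N x,
    Submodule.mem_iSup_of_mem (p := fun n => superComponent E F b₀ b₁ N n ⊓ vectParity N 1) 1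
      ⟨Submodule.mem_sup_right ⟨x, rfl⟩, oddField_parity E F b₀ b₁ N x⟩⟩

end Super

end

end QueerProlong

open QueerProlong

namespace QueerProlong

set_option linter.unusedSectionVars false

noncomputable section

open DPoly

/-! ### Projections of divided powers onto sets of monomials -/

namespace DPoly

variable {K : Type*} [Field K] {κ : Type*}

/-! Write x_i for the even and ξ_i for the odd indeterminates on V ⊕ Π(V). In characteristic 2 the
element x_i + ξ_i squares to zero: ξ_i² = 0, x_i² = 2 x_i^(2) = 0, and the cross term is 2 x_i ξ_i.
Hence f(z) ↦ f(x + ξ) is an algebra homomorphism (`double`) from the divided powers with exponents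
at most 1 to the functions on V ⊕ Π(V), whatever the shearing vector N is. By the chain rule
`pd_double`, both ∂/∂x_i and ∂/∂ξ_i act on its image as ∂_i acts on f.

A field D = ∑ f_i ∂_i on V and a parity ε give the field `doubleField N ε D`, whose coefficient at
∂/∂x_i is the part of f_i(x + ξ) of parity ε, and at ∂/∂ξ_i the part of parity ε + 1. The two parts
add up to f_i(x + ξ), so this field acts on functions of x + ξ as D does (`doubleField_double`). A
field of parity ε also commutes with the parity projections up to the shift by ε
(`apply_homogProj`). These two facts give the composition law `doubleField_doubleField_z`, hence
compatibility with brackets and with squares of odd fields. On constant and linear fields, ε = 0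
yields v and x, and ε = 1 yields Π(v) and Π(x); as brackets with the ∂'s are again doubles, doubling
maps each component of the first prolong into the component of the same degree of the second.

The substance is surjectivity, `doubleField_undouble_of_mem`, by induction on the degree. Let D be
homogeneous of positive degree in the big prolong. By induction its brackets with ∂/∂x_i and ∂/∂ξ_i
are doubles of fields E(x_i) and E(ξ_i) on V. Since the ∂'s commute, [E(x_i), ∂_j] = [E(ξ_j), ∂_i] =
[E(ξ_i), ∂_j] for all j, and a field of degree at least 0 is determined by its brackets with the ∂_j
(`eq_zero_of_lie_pd`); so E(x_i) = E(ξ_i). As ∂/∂ξ_i squares to zero, [E(ξ_i), ∂_i] = 0, and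
therefore the double bracket of D with ∂/∂x_i vanishes as well. This is what makes N irrelevant: no
higher divided power of x_i contributes to D. The candidate preimage `undouble N D` has coefficients
D(x_i + ξ_i) restricted to ξ = 0 and to exponents at most 1; the vanishing just found shows that its
brackets with the ∂_i are the E's, so its double has the same brackets with all ∂'s as D, and equals
D. -/

open Classical in
/-- The projection onto the span of the `z^(r)` with `r ∈ S`. -/
def restrict (S : Set (κ → ℕ)) : DPoly K κ →ₗ[K] DPoly K κ where
  toFun := fun f => (Finsupp.filter (· ∈ S) (f : (κ → ℕ) →₀ K) : (κ → ℕ) →₀ K)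
  map_add' := fun _ _ => Finsupp.filter_add
  map_smul' := fun _ _ => Finsupp.filter_smul

theorem coeff_restrict_of_mem {S : Set (κ → ℕ)} {r : κ → ℕ} (h : r ∈ S) (f : DPoly K κ) :
    coeff r (restrict S f) = coeff r f := by
  classical
  exact Finsupp.filter_apply_pos (· ∈ S) (f : (κ → ℕ) →₀ K) h

theorem coeff_restrict_of_notMem {S : Set (κ → ℕ)} {r : κ → ℕ} (h : r ∉ S) (f : DPoly K κ) :
    coeff r (restrict S f) = 0 := by
  classical
  exact Finsupp.filter_apply_neg (· ∈ S) (f : (κ → ℕ) →₀ K) h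

theorem restrict_mem_supported (S : Set (κ → ℕ)) (f : DPoly K κ) :
    restrict S f ∈ supported S := fun r hr => by
  by_contra h
  exact hr (coeff_restrict_of_notMem h f)

theorem restrict_mem_of_mem (S : Set (κ → ℕ)) {T : Set (κ → ℕ)} {f : DPoly K κ}
    (hf : f ∈ supported T) : restrict S f ∈ supported T := fun r hr => by
  by_cases h : r ∈ S
  · rw [coeff_restrict_of_mem h] at hr; exact hf r hr
  · exact absurd (coeff_restrict_of_notMem h f) hr

end DPoly

/-! ### Homogeneous projections, and detection of fields by their brackets with the ∂'s -/

section Truncated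

variable {K : Type*} [Field K] [CharP K 2] {κ : Type*} [Fintype κ] {N : κ → WithTop ℕ+}
  {M : Type*} [AddCommGroup M]

variable (K N) in
/-- The projection of `𝒪(κ; N)` onto the elements of weight `d`, where `z_i` has weight `w i`. -/
def homogProj (w : κ → M) (d : M) : truncated K N →ₗ[K] truncated K N :=
  (restrict {r | ∑ i, r i • w i = d} ∘ₗ (truncated K N).val.toLinearMap).codRestrict
    (Subalgebra.toSubmodule (truncated K N)) fun f => restrict_mem_of_mem _ f.2

theorem coe_homogProj (w : κ → M) (d : M) (f : truncated K N) :
    (homogProj K N w d f : DPoly K κ) = restrict {r | ∑ i, r i • w i = d} f.1 := rfl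

theorem homogProj_mem (w : κ → M) (d : M) (f : truncated K N) :
    homogProj K N w d f ∈ homog K N w d := restrict_mem_supported _ f.1

theorem homogProj_mem_of_mem (w : κ → M) (d : M) {M' : Type*} [AddCommGroup M'] {w' : κ → M'}
    {d' : M'} {f : truncated K N} (hf : f ∈ homog K N w' d') :
    homogProj K N w d f ∈ homog K N w' d' := restrict_mem_of_mem _ hf

theorem homogProj_of_mem {w : κ → M} {d : M} {f : truncated K N} (hf : f ∈ homog K N w d) :
    homogProj K N w d f = f := by
  refine Subtype.ext (DPoly.ext fun r => ?_)
  rw [coe_homogProj]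
  by_cases h : r ∈ {r : κ → ℕ | ∑ i, r i • w i = d}
  · rw [coeff_restrict_of_mem h]
  · rw [coeff_restrict_of_notMem h]
    by_contra hc
    exact h (hf r (Ne.symm hc))

variable [DecidableEq κ]

theorem homogProj_of_mem_ne {w : κ → M} {d e : M} (hde : d ≠ e) {f : truncated K N}
    (hf : f ∈ homog K N w e) : homogProj K N w d f = 0 :=
  eq_zero_of_homog hde (homogProj_mem w d f) (homogProj_mem_of_mem w d hf)

theorem zmod_two_cases (ε δ : ZMod 2) : ε = δ ∨ ε = δ + 1 := by
  revert ε δ; decide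

theorem homogProj_add_homogProj (w : κ → ZMod 2) (ε : ZMod 2) (f : truncated K N) :
    homogProj K N w ε f + homogProj K N w (ε + 1) f = f := by
  refine Subtype.ext (DPoly.ext fun r => ?_)
  change coeff r (restrict _ f.1 + restrict _ f.1) = coeff r f.1
  rw [map_add]
  rcases zmod_two_cases (∑ i, r i • w i) ε with h | h
  · rw [coeff_restrict_of_mem (by exact h), coeff_restrict_of_notMem (by
      simp only [Set.mem_ofPred_eq, h]; simp), add_zero]
  · rw [coeff_restrict_of_mem (S := {r : κ → ℕ | ∑ i, r i • w i = ε + 1}) (by exact h),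
      coeff_restrict_of_notMem (by simp only [Set.mem_ofPred_eq, h]; simp), zero_add]

/-- Split f into its two parity components: D shifts both parities by δ, so the projection of D f
keeps the image of one component and kills the image of the other. -/
theorem apply_homogProj {w : κ → ZMod 2} {δ : ZMod 2} {D : Der K N} (hD : D ∈ vect K N w δ)
    (ε : ZMod 2) (f : truncated K N) :
    D (homogProj K N w ε f) = homogProj K N w (δ + ε) (D f) := by
  conv_rhs => rw [← homogProj_add_homogProj w ε f, map_add, map_add]
  rw [homogProj_of_mem (apply_mem_homog hD (homogProj_mem w ε f)),
    homogProj_of_mem_ne (e := δ + (ε + 1)) (by simp) (apply_mem_homog hD (homogProj_mem w _ f)),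
    add_zero]

theorem prod_pow_mem_homog {w : κ → M} {σ : Type*} (s : Finset σ) {y : σ → truncated K N}
    {u : σ → M} (hy : ∀ i, y i ∈ homog K N w (u i)) (r : σ → ℕ) :
    ∏ i ∈ s, y i ^ r i ∈ homog K N w (∑ i ∈ s, r i • u i) := by
  have hpow : ∀ i n, y i ^ n ∈ homog K N w (n • u i) := fun i n => by
    induction n with
    | zero => rw [pow_zero, zero_smul]; exact one_mem_homog w
    | succ n ih => rw [pow_succ, succ_nsmul]; exact mul_mem_homog ih (hy i)
  classical
  induction s using Finset.induction_on with
  | empty => simpa using one_mem_homog (K := K) (N := N) w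
  | insert a s ha ih =>
    rw [Finset.prod_insert ha, Finset.sum_insert ha]
    exact mul_mem_homog (hpow a _) ih

/-- Since ∂_i z_k is constant, the bracket takes the value -∂_i(D z_k) at z_k. So all partial
derivatives of D z_k vanish and D z_k is constant; but its degree is d + 1 > 0. This is the
uniqueness principle by which fields in the prolong are compared. -/
theorem eq_zero_of_lie_pd {d : ℤ} (hd : 0 ≤ d) {D : Der K N} (hD : D ∈ vectDeg K N d)
    (h : ∀ i, ⁅D, pd K N i⁆ = 0) : D = 0 := by
  rw [hD.1]
  refine Finset.sum_eq_zero fun k _ => ?_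
  suffices hk : D (z K N k) = 0 by rw [hk, zero_smul]
  have hz : ∀ i, pd K N i (D (z K N k)) = 0 := fun i => by
    have := congrArg (fun E : Der K N => E (z K N k)) (h i)
    simp only [Derivation.commutator_apply, pd_z, Derivation.zero_apply] at this
    split_ifs at this
    · simpa using this
    · simpa using this
  refine Subtype.ext (DPoly.ext fun r => ?_)
  by_contra hc
  -- The constant term is excluded by the degree; any other coefficient of D z_k is a coefficient of
  -- one of its partial derivatives.
  by_cases hr : r = 0
  · have := hD.2 k r hc
    simp only [Set.mem_ofPred_eq, hr] at this
    simp at this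
    omega
  · obtain ⟨i, hi⟩ := Function.ne_iff.1 hr
    obtain ⟨s, rfl⟩ := exists_add_single hi
    have := congrArg (fun f : truncated K N => coeff s f.1) (hz i)
    simp only [coe_pd, coeff_pdLin] at this
    exact hc this

end Truncated

/-! ### The homomorphism f(z) ↦ f(x + ξ) -/

section Double

variable {K : Type*} [Field K] [CharP K 2] {ι : Type*} [Fintype ι] [DecidableEq ι]
  {N : ι → WithTop ℕ+}

theorem mem_box_shearOne {r : ι → ℕ} : r ∈ box (shearOne ι) ↔ ∀ i, r i ≤ 1 := by
  constructor
  · intro h i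
    have := h i 1 le_rfl
    simp at this
    omega
  · intro h i m _
    exact lt_of_le_of_lt (h i) (Nat.one_lt_two_pow m.ne_zero)

theorem mono_eq_mono_mul_z {s : ι → ℕ} {i : ι} (h : s i = 0) (a : K) :
    mono (s + Pi.single i 1) a = mono s a * (z K (shearOne ι) i : DPoly K ι) := by
  change _ = mono s a * mono (Pi.single i 1) 1
  rw [mono_mul_mono, binom_comm, ← zero_add (Pi.single i 1), binom_single_left h, binom_zero_left]
  simp

theorem mono_mem_adjoin (n : ℕ) : ∀ r ∈ box (shearOne ι), ∑ i, r i = n → ∀ a : K,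
    mono r a ∈ (Algebra.adjoin K (Set.range (z K (shearOne ι)))).map
      (truncated K (shearOne ι)).val := by
  induction n with
  | zero =>
    intro r _ h a
    have h0 : r = 0 := funext fun i => by
      rw [Finset.sum_eq_zero_iff] at h
      exact h i (Finset.mem_univ i)
    rw [h0, show mono (0 : ι → ℕ) a = a • (1 : DPoly K ι) by
      rw [one_def, smul_mono, mul_one]]
    exact Subalgebra.smul_mem _ (one_mem _) a
  | succ n ih =>
    intro r hr h a
    obtain ⟨i, hi⟩ : ∃ i, r i ≠ 0 := by
      by_contra! hc
      simp [hc] at h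
    obtain ⟨s, rfl⟩ := exists_add_single hi
    have hs : s i = 0 := by
      have := mem_box_shearOne.1 hr i
      simp at this
      exact this
    rw [mono_eq_mono_mul_z hs]
    refine mul_mem (ih s (box_of_add hr) ?_ a) ⟨_, Algebra.subset_adjoin ⟨i, rfl⟩, rfl⟩
    simp only [Pi.add_apply, Finset.sum_add_distrib, Finset.sum_pi_single', Finset.mem_univ,
      if_true] at h
    simpa using h

/-- A monomial with exponents at most 1 is the plain product of its indeterminates, as all binomial
coefficients involved are 1. It allows identities between derivations to be checked on the z_i
alone; with larger exponents this fails, since z_i² = 2 z_i^(2) = 0. -/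
theorem adjoin_range_z : Algebra.adjoin K (Set.range (z K (shearOne ι))) = ⊤ := by
  refine eq_top_iff.2 fun f _ => ?_
  have h : f.1 ∈ (Algebra.adjoin K (Set.range (z K (shearOne ι)))).map
      (truncated K (shearOne ι)).val :=
    supported_induction (S := box (shearOne ι)) (P := fun f => f ∈ _) (zero_mem _)
      (fun _ _ => add_mem) (fun r hr a => mono_mem_adjoin _ r hr rfl a) f.1 f.2
  obtain ⟨g, hg, hgf⟩ := h
  rwa [← Subtype.ext hgf]

/-- The index in `ι` of the indeterminates `x_i` and `ξ_i`. -/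
def index (k : ι ⊕ ι) : ι := Sum.elim id id k

variable (K N) in
/-- The elements `x_i + ξ_i`. -/
def zSum (i : ι) : truncated K (superShear ι N) :=
  z K (superShear ι N) (Sum.inl i) + z K (superShear ι N) (Sum.inr i)

theorem zSum_mem : ∀ i : ι, zSum K N i ∈ homog K (superShear ι N) (fun _ => (1 : ℤ)) 1 :=
  fun _ => add_mem (z_mem_homog _ _) (z_mem_homog _ _)

/-- Elements of nonzero degree square to zero in characteristic 2. This relation makes the
substitution z_i ↦ x_i + ξ_i legitimate for every N. -/
theorem zSum_mul_self (i : ι) : zSum K N i * zSum K N i = 0 :=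
  mul_self_eq_zero_of_homog one_ne_zero (zSum_mem i)

variable (K N) in
/-- The linear map `z^(r) ↦ ∏ (x_i + ξ_i)^(r_i)`. -/
def doubleLin : DPoly K ι →ₗ[K] truncated K (superShear ι N) :=
  lift fun r => ∏ i, zSum K N i ^ r i

theorem doubleLin_mono (r : ι → ℕ) (a : K) :
    doubleLin K N (mono r a) = a • ∏ i, zSum K N i ^ r i := lift_mono _ r a

theorem doubleLin_one : doubleLin K N (1 : DPoly K ι) = 1 := by
  rw [one_def, doubleLin_mono]; simp

/-- Either some r_i = s_i = 1, and the product contains the vanishing square of x_i + ξ_i, or no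
exponents collide and the binomial coefficient is 1. Hence the divided power product on the source
matches the ordinary product on the target. -/
theorem binom_smul_prod {r s : ι → ℕ} (hr : r ∈ box (shearOne ι)) (hs : s ∈ box (shearOne ι)) :
    (binom r s : K) • ∏ i, zSum K N i ^ (r + s) i = ∏ i, zSum K N i ^ (r + s) i := by
  by_cases h : ∃ i, r i = 1 ∧ s i = 1
  · obtain ⟨i, h1, h2⟩ := h
    rw [Finset.prod_eq_zero (Finset.mem_univ i), smul_zero]
    rw [Pi.add_apply, h1, h2, pow_succ, pow_one, zSum_mul_self]
  · have : binom r s = 1 := Finset.prod_eq_one fun i _ => by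
      have h1 := mem_box_shearOne.1 hr i
      have h2 := mem_box_shearOne.1 hs i
      by_cases hi : r i = 0
      · rw [hi, Nat.choose_zero_right]
      · have h3 : r i = 1 := by omega
        have h4 : s i = 0 := by
          by_contra h4
          exact h ⟨i, h3, by omega⟩
        rw [h3, h4]; rfl
    rw [this, Nat.cast_one, one_smul]

theorem doubleLin_mul {f g : DPoly K ι} (hf : f ∈ supported (box (shearOne ι)))
    (hg : g ∈ supported (box (shearOne ι))) :
    doubleLin K N (f * g) = doubleLin K N f * doubleLin K N g := by
  refine supported_induction (P := fun f => doubleLin K N (f * g) =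
    doubleLin K N f * doubleLin K N g) (by simp) ?_ ?_ f hf
  · intro f₁ f₂ h1 h2; rw [add_mul, map_add, h1, h2, map_add, add_mul]
  · intro r hr a
    refine supported_induction (P := fun g => doubleLin K N (mono r a * g) =
      doubleLin K N (mono r a) * doubleLin K N g) (by simp) ?_ ?_ g hg
    · intro f₁ f₂ h1 h2; rw [mul_add, map_add, h1, h2, map_add, mul_add]
    · intro s hs c
      rw [mono_mul_mono, doubleLin_mono, doubleLin_mono, doubleLin_mono, mul_smul,
        binom_smul_prod hr hs, smul_mul_smul_comm, ← Finset.prod_mul_distrib]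
      simp only [Pi.add_apply, pow_add]

variable (K N) in
/-- The homomorphism `𝒪(ι; N_s) → 𝒪(ι ⊔ ι; N)` that sends `z_i` to `x_i + ξ_i`. -/
def double : truncated K (shearOne ι) →ₐ[K] truncated K (superShear ι N) :=
  AlgHom.ofLinearMap (doubleLin K N ∘ₗ (truncated K (shearOne ι)).val.toLinearMap)
    doubleLin_one fun f g => doubleLin_mul f.2 g.2

theorem double_z (i : ι) : double K N (z K (shearOne ι) i) = zSum K N i := by
  refine (doubleLin_mono (Pi.single i 1) (1 : K)).trans ?_
  rw [one_smul, Finset.prod_eq_single i]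
  · simp
  · intro j _ hj; simp [hj]
  · simp

theorem double_mem_homog {d : ℤ} {f : truncated K (shearOne ι)}
    (hf : f ∈ homog K (shearOne ι) (fun _ => (1 : ℤ)) d) :
    double K N f ∈ homog K (superShear ι N) (fun _ => (1 : ℤ)) d := by
  refine supported_induction (P := fun f => doubleLin K N f ∈
    homog K (superShear ι N) (fun _ => (1 : ℤ)) d) (by simp) ?_ ?_ f.1 hf
  · intro f₁ f₂ h1 h2; rw [map_add]; exact add_mem h1 h2
  · intro r hr a
    rw [doubleLin_mono, ← show _ = d from hr]
    exact Submodule.smul_mem _ _ (prod_pow_mem_homog _ zSum_mem r)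

/-- The chain rule. Both sides satisfy the Leibniz rule along `double`, so it is enough to compare
them on the generators z_i, where x_i + ξ_i has derivative 1 in each of its two variables. -/
theorem pd_double (k : ι ⊕ ι) (f : truncated K (shearOne ι)) :
    pd K (superShear ι N) k (double K N f) = double K N (pd K (shearOne ι) (index k) f) := by
  have hf : f ∈ Algebra.adjoin K (Set.range (z K (shearOne ι))) := by
    rw [adjoin_range_z]; trivial
  induction hf using Algebra.adjoin_induction with
  | mem f hf =>
    obtain ⟨i, rfl⟩ := hf
    rw [double_z, zSum, map_add, pd_z, pd_z, pd_z]
    rcases k with k | k <;> by_cases h : k = i <;> simp [index, h]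
  | algebraMap c => simp only [AlgHom.commutes, Derivation.map_algebraMap, map_zero]
  | add f g _ _ h1 h2 => simp only [map_add, h1, h2]
  | mul f g _ _ h1 h2 => simp only [map_mul, Derivation.leibniz, map_add, smul_eq_mul, h1, h2]

theorem coeff_zero_double (f : truncated K (shearOne ι)) :
    coeff 0 (double K N f).1 = coeff 0 f.1 := by
  refine supported_induction (P := fun f => coeff 0 (doubleLin K N f).1 = coeff 0 f) ?_ ?_ ?_
    f.1 f.2
  · simp
  · intro f₁ f₂ h1 h2
    rw [map_add, map_add (coeff 0) f₁, ← h1, ← h2]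
    exact map_add (coeff 0) _ _
  · intro r hr a
    by_cases h : r = 0
    · subst h
      rw [coeff_mono_same, doubleLin_mono]
      simp only [Pi.zero_apply, pow_zero, Finset.prod_const_one]
      change coeff 0 (a • mono 0 1) = a
      rw [smul_mono, mul_one, coeff_mono_same]
    · rw [coeff_mono_ne (Ne.symm h)]
      by_contra hc
      have hm : double K N ⟨mono r a, mono_mem_supported hr a⟩ ∈
          homog K (superShear ι N) (fun _ => (1 : ℤ)) (∑ i, r i • 1) :=
        double_mem_homog (mono_mem_supported (S := {s | ∑ i, s i • (1 : ℤ) = ∑ i, r i • 1}) rfl a)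
      have h0 : ∑ _i : ι ⊕ ι, (0 : ℕ) • (1 : ℤ) = ∑ i, r i • (1 : ℤ) := hm 0 hc
      simp only [zero_smul, Finset.sum_const_zero, nsmul_eq_mul, mul_one] at h0
      have h1 := (Finset.sum_eq_zero_iff_of_nonneg (fun j _ => by simp)).1 h0.symm
      exact h (funext fun j => by simpa using h1 j (Finset.mem_univ j))

/-! ### Restriction to ξ = 0 -/

variable (K N) in
/-- The restriction to `ξ = 0`, followed by the projection onto the span of the `z^(r)` with
`r_i ≤ 1`. -/
def evenRestrict : truncated K (superShear ι N) →ₗ[K] truncated K (shearOne ι) :=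
  (restrict (box (shearOne ι)) ∘ₗ
    (Finsupp.lcomapDomain (fun r : ι → ℕ => (Sum.elim r 0 : ι ⊕ ι → ℕ))
      (fun _ _ h => funext fun i => congrFun h (Sum.inl i)) :
      ((ι ⊕ ι → ℕ) →₀ K) →ₗ[K] ((ι → ℕ) →₀ K)) ∘ₗ
    (truncated K (superShear ι N)).val.toLinearMap).codRestrict
    (Subalgebra.toSubmodule (truncated K (shearOne ι))) fun _ => restrict_mem_supported _ _

theorem coeff_evenRestrict {r : ι → ℕ} (hr : r ∈ box (shearOne ι))
    (f : truncated K (superShear ι N)) :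
    coeff r (evenRestrict K N f).1 = coeff (Sum.elim r 0) f.1 := coeff_restrict_of_mem hr _

theorem evenRestrict_mem_homog {d : ℤ} {f : truncated K (superShear ι N)}
    (hf : f ∈ homog K (superShear ι N) (fun _ => (1 : ℤ)) d) :
    evenRestrict K N f ∈ homog K (shearOne ι) (fun _ => (1 : ℤ)) d := by
  intro r hr
  have h : r ∈ box (shearOne ι) := (evenRestrict K N f).2 r hr
  rw [show ((truncated K (shearOne ι)).val.toLinearMap (evenRestrict K N f)) =
    (evenRestrict K N f).1 from rfl, coeff_evenRestrict h] at hr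
  have := hf _ hr
  simpa [Fintype.sum_sum_type] using this

theorem elim_add_single (r : ι → ℕ) (i : ι) : (Sum.elim (r + Pi.single i 1) 0 : ι ⊕ ι → ℕ) =
    Sum.elim r 0 + Pi.single (Sum.inl i) 1 := by
  funext k
  rcases k with k | k
  · by_cases h : k = i
    · subst h; simp
    · simp [h]
  · simp

/-- A divided power coefficient is the constant term of an iterated derivative. Derivatives in the
x_i pass through `double` by `pd_double`, and constant terms are preserved. -/
theorem coeff_elim_double (n : ℕ) : ∀ r : ι → ℕ, ∑ i, r i = n → ∀ f : truncated K (shearOne ι),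
    coeff (Sum.elim r 0) (double K N f).1 = coeff r f.1 := by
  induction n with
  | zero =>
    intro r h f
    have h0 : r = 0 := funext fun i => by
      rw [Finset.sum_eq_zero_iff] at h
      exact h i (Finset.mem_univ i)
    rw [h0, show (Sum.elim (0 : ι → ℕ) 0 : ι ⊕ ι → ℕ) = 0 from Sum.elim_zero_zero,
      coeff_zero_double]
  | succ n ih =>
    intro r h f
    obtain ⟨i, hi⟩ : ∃ i, r i ≠ 0 := by
      by_contra! hc
      simp [hc] at h
    obtain ⟨s, rfl⟩ := exists_add_single hi
    rw [elim_add_single, ← coeff_pdLin, ← coeff_pdLin, ← coe_pd, ← coe_pd, pd_double]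
    refine ih s ?_ _
    simp only [Pi.add_apply, Finset.sum_add_distrib, Finset.sum_pi_single', Finset.mem_univ,
      if_true] at h
    simpa using h

theorem evenRestrict_double (f : truncated K (shearOne ι)) :
    evenRestrict K N (double K N f) = f := by
  refine Subtype.ext (DPoly.ext fun r => ?_)
  by_cases hr : r ∈ box (shearOne ι)
  · rw [coeff_evenRestrict hr, coeff_elim_double _ r rfl]
  · have h : ∀ g : truncated K (shearOne ι), coeff r g.1 = 0 := fun g => by
      by_contra hc
      exact hr (g.2 r hc)
    rw [h, h]

/-- Restriction to ξ = 0 commutes with ∂/∂x_i, but cutting off exponents above 1 does not: a term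
with x_i^(2) is dropped while its derivative may survive. The hypothesis that the second derivative
vanishes excludes such terms. -/
theorem pd_evenRestrict (i : ι) {f : truncated K (superShear ι N)}
    (hf : pd K (superShear ι N) (Sum.inl i) (pd K (superShear ι N) (Sum.inl i) f) = 0) :
    pd K (shearOne ι) i (evenRestrict K N f) =
      evenRestrict K N (pd K (superShear ι N) (Sum.inl i) f) := by
  refine Subtype.ext (DPoly.ext fun r => ?_)
  rw [coe_pd, coeff_pdLin]
  by_cases h : r + Pi.single i 1 ∈ box (shearOne ι)
  · rw [coeff_evenRestrict h, coeff_evenRestrict (box_of_add h), coe_pd, coeff_pdLin,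
      elim_add_single]
  · have h1 : coeff (r + Pi.single i 1) (evenRestrict K N f).1 = 0 := by
      by_contra hc
      exact h ((evenRestrict K N f).2 _ hc)
    rw [h1]
    by_cases hr : r ∈ box (shearOne ι)
    -- Here r is admissible and r + e_i is not, so r_i = 1; the coefficient of the first derivative
    -- at r is then a coefficient of the second derivative.
    · have hri : r i ≠ 0 := by
        intro h0
        refine h (mem_box_shearOne.2 fun j => ?_)
        by_cases hj : j = i
        · subst hj; simp [h0]
        · simpa [hj] using mem_box_shearOne.1 hr j
      obtain ⟨s, rfl⟩ := exists_add_single hri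
      rw [coeff_evenRestrict hr, elim_add_single, ← coeff_pdLin, ← coe_pd, hf]
      rfl
    · by_contra hc
      exact hr ((evenRestrict K N _).2 _ (Ne.symm hc))

end Double

/-! ### Doubling of vector fields -/

section DoubleField

variable {K : Type*} [Field K] [CharP K 2] {ι : Type*} [Fintype ι] [DecidableEq ι]
  {N : ι → WithTop ℕ+}

variable (K N) in
/-- The projection of `𝒪(ι ⊔ ι; N)` onto the elements of parity `ε`. -/
abbrev parityProj (ε : ZMod 2) :
    truncated K (superShear ι N) →ₗ[K] truncated K (superShear ι N) :=
  homogProj K (superShear ι N) (parity ι ι) ε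

variable (N) in
/-- The vector field of parity `ε` on `V ⊕ Π(V)` that corresponds to a vector field `D` on `V`:
on a function `f(x + ξ)` it acts as `D`. -/
def doubleField (ε : ZMod 2) : Der K (shearOne ι) →ₗ[K] Der K (superShear ι N) where
  toFun := fun D => ∑ k, parityProj K N (ε + parity ι ι k)
    (double K N (D (z K (shearOne ι) (index k)))) • pd K (superShear ι N) k
  map_add' := fun D E => by simp [add_smul, Finset.sum_add_distrib]
  map_smul' := fun c D => by simp [Finset.smul_sum]

theorem doubleField_z (ε : ZMod 2) (D : Der K (shearOne ι)) (k : ι ⊕ ι) :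
    doubleField N ε D (z K (superShear ι N) k) =
      parityProj K N (ε + parity ι ι k) (double K N (D (z K (shearOne ι) (index k)))) := by
  change (∑ j, _ • pd K (superShear ι N) j) _ = _
  rw [der_sum_apply, Finset.sum_eq_single k]
  · simp [pd_z]
  · intro j _ hj; simp [pd_z, hj]
  · simp

theorem doubleField_apply (ε : ZMod 2) (D : Der K (shearOne ι))
    (f : truncated K (superShear ι N)) : doubleField N ε D f =
      ∑ k, doubleField N ε D (z K (superShear ι N) k) * pd K (superShear ι N) k f := by
  simp only [doubleField_z]
  simp [doubleField, der_sum_apply]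

theorem doubleField_parity (ε : ZMod 2) (D : Der K (shearOne ι)) :
    doubleField N ε D ∈ vectParity (κ := ι) N ε :=
  vect_of_apply (doubleField_apply ε D) fun k => by
    rw [doubleField_z]; exact homogProj_mem _ _ _

theorem doubleField_degree (ε : ZMod 2) {d : ℤ} {D : Der K (shearOne ι)}
    (hD : D ∈ vectDeg K (shearOne ι) d) :
    doubleField N ε D ∈ vectDeg K (superShear ι N) d :=
  vect_of_apply (doubleField_apply ε D) fun k => by
    rw [doubleField_z]
    exact homogProj_mem_of_mem _ _ (double_mem_homog (hD.2 _))

theorem parityProj_add (ε : ZMod 2) (f : truncated K (superShear ι N)) (i : ι) :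
    parityProj K N (ε + parity ι ι (Sum.inl i)) f +
      parityProj K N (ε + parity ι ι (Sum.inr i)) f = f := by
  simp only [parity, Sum.elim_inl, Sum.elim_inr, add_zero]
  exact homogProj_add_homogProj (parity ι ι) ε f

theorem doubleField_zSum (ε : ZMod 2) (D : Der K (shearOne ι)) (i : ι) :
    doubleField N ε D (zSum K N i) = double K N (D (z K (shearOne ι) i)) := by
  rw [zSum, map_add, doubleField_z, doubleField_z]
  exact parityProj_add ε _ i

variable (K) in
/-- The vector fields `∑ f_i ∂_i`. -/
def vectAll {κ : Type*} [Fintype κ] [DecidableEq κ] (N : κ → WithTop ℕ+) :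
    Submodule K (Der K N) where
  carrier := {D | D = ∑ i, D (z K N i) • pd K N i}
  zero_mem' := by simp
  add_mem' := fun {D E} hD hE => by
    simp only [Set.mem_ofPred_eq, Derivation.add_apply, add_smul, Finset.sum_add_distrib] at *
    rw [← hD, ← hE]
  smul_mem' := fun c D hD => by
    simp only [Set.mem_ofPred_eq, Derivation.smul_apply, smul_assoc, ← Finset.smul_sum] at *
    rw [← hD]

/-- The derivatives of f(x + ξ) in x_i and in ξ_i coincide, so they can be factored out; the
coefficients in front of them are complementary parity components and add up to (D z_i)(x + ξ). -/
theorem doubleField_double (ε : ZMod 2) {D : Der K (shearOne ι)}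
    (hD : D ∈ vectAll K (shearOne ι)) (f : truncated K (shearOne ι)) :
    doubleField N ε D (double K N f) = double K N (D f) := by
  rw [doubleField_apply, Fintype.sum_sum_type, ← Finset.sum_add_distrib]
  have h : D f = ∑ i, D (z K (shearOne ι) i) * pd K (shearOne ι) i f := by
    conv_lhs => rw [show D = _ from hD]
    simp [der_sum_apply]
  rw [h, map_sum]
  refine Finset.sum_congr rfl fun i _ => ?_
  rw [pd_double, pd_double, map_mul, doubleField_z, doubleField_z]
  change _ * double K N (pd K (shearOne ι) i f) + _ * double K N (pd K (shearOne ι) i f) = _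
  rw [← add_mul]
  exact congrArg (· * _) (parityProj_add ε _ i)

/-- The composition law behind both the bracket and the squaring: the outer field passes through the
parity projection with a shift by ε, and then acts on a function of x + ξ as D does. -/
theorem doubleField_doubleField_z (ε δ : ZMod 2) {D : Der K (shearOne ι)}
    (hD : D ∈ vectAll K (shearOne ι)) (E : Der K (shearOne ι)) (k : ι ⊕ ι) :
    doubleField N ε D (doubleField N δ E (z K (superShear ι N) k)) =
      parityProj K N (ε + δ + parity ι ι k)
        (double K N (D (E (z K (shearOne ι) (index k))))) := by
  rw [doubleField_z, apply_homogProj (doubleField_parity ε D), doubleField_double ε hD, add_assoc]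

theorem doubleField_lie (ε δ : ZMod 2) {D E : Der K (shearOne ι)}
    (hD : D ∈ vectAll K (shearOne ι)) (hE : E ∈ vectAll K (shearOne ι)) :
    ⁅doubleField N ε D, doubleField N δ E⁆ = doubleField N (ε + δ) ⁅D, E⁆ := by
  refine vect_ext (lie_mem_vect (doubleField_parity ε D) (doubleField_parity δ E))
    (doubleField_parity _ _) fun k => ?_
  rw [Derivation.commutator_apply, doubleField_doubleField_z ε δ hD,
    doubleField_doubleField_z δ ε hE, doubleField_z, Derivation.commutator_apply, map_sub, map_sub,
    add_comm δ]

theorem derSq_doubleField {D : Der K (shearOne ι)} (hD : D ∈ vectAll K (shearOne ι)) :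
    derSq (doubleField N 1 D) = doubleField N 0 (derSq D) := by
  refine vect_ext (derSq_mem_vect (doubleField_parity 1 D) fun k => ?_)
    (doubleField_parity _ _) fun k => ?_
  -- The square of a field is again a field ∑ f_k ∂_k because, for each k, either the coefficient is
  -- odd and squares to zero (k even) or ∂_k squares to zero (k odd).
  · exact oddField_sq_cond N (doubleField_parity 1 D) k
  · rw [derSq_apply, doubleField_doubleField_z 1 1 hD, doubleField_z]; rfl

theorem parity_add_self (k : ι ⊕ ι) : parity ι ι k + parity ι ι k = 0 := CharTwo.add_self_eq_zero _

/-- The only nonzero coefficient of ∂_i is the even constant 1. The projection keeps it exactly at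
the indeterminate over i with the prescribed parity. Brackets with any ∂ on V ⊕ Π(V) thereby become
brackets of doubles. -/
theorem doubleField_pd (k : ι ⊕ ι) :
    doubleField N (parity ι ι k) (pd K (shearOne ι) (index k)) = pd K (superShear ι N) k := by
  refine vect_ext (doubleField_parity _ _) (pd_mem_vect (parity ι ι) k) fun j => ?_
  rw [doubleField_z, pd_z, pd_z]
  have h1 : double K N (if index k = index j then 1 else 0) ∈
      homog K (superShear ι N) (parity ι ι) 0 := by
    split_ifs
    · rw [map_one]; exact one_mem_homog _
    · rw [map_zero]; exact zero_mem _
  by_cases h : parity ι ι k = parity ι ι j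
  · rw [h, parity_add_self, homogProj_of_mem h1]
    have hk : index k = index j ↔ k = j := by
      rcases k with k | k <;> rcases j with j | j <;> simp_all [index, parity]
    by_cases hi : index k = index j
    · rw [if_pos hi, if_pos (hk.1 hi), map_one]
    · rw [if_neg hi, if_neg (hi ∘ hk.2), map_zero]
  · rw [homogProj_of_mem_ne _ h1, if_neg]
    · rintro rfl; exact h rfl
    · intro h0
      refine h ?_
      rwa [← CharTwo.sub_eq_add, sub_eq_zero] at h0

/-! ### The candidate inverse of doubling -/

variable (N) in
/-- The vector field on `V` that corresponds to a vector field on `V ⊕ Π(V)`. -/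
def undouble : Der K (superShear ι N) →ₗ[K] Der K (shearOne ι) where
  toFun := fun D => ∑ i, evenRestrict K N (D (zSum K N i)) • pd K (shearOne ι) i
  map_add' := fun D E => by simp [add_smul, Finset.sum_add_distrib]
  map_smul' := fun c D => by simp [Finset.smul_sum]

theorem undouble_z (D : Der K (superShear ι N)) (i : ι) :
    undouble N D (z K (shearOne ι) i) = evenRestrict K N (D (zSum K N i)) := by
  simp [undouble, der_sum_apply, pd_z]

theorem undouble_degree {d : ℤ} {D : Der K (superShear ι N)}
    (hD : D ∈ vectDeg K (superShear ι N) d) : undouble N D ∈ vectDeg K (shearOne ι) d := by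
  refine vect_of_apply (fun f => ?_) fun i => ?_
  · simp only [undouble_z]
    simp [undouble, der_sum_apply]
  · rw [undouble_z, zSum, map_add]
    exact evenRestrict_mem_homog (add_mem (hD.2 _) (hD.2 _))

theorem undouble_doubleField (ε : ZMod 2) {D : Der K (shearOne ι)}
    (hD : D ∈ vectAll K (shearOne ι)) : undouble N (doubleField N ε D) = D := by
  conv_rhs => rw [show D = _ from hD]
  change ∑ i, _ = _
  simp only [doubleField_zSum, evenRestrict_double]

/-- Base of the induction in degree -1. The values D x_i and D ξ_i are constants, hence unaffected
by restriction followed by doubling. They have opposite parities ε and ε + 1, so the projections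
recover each of them from their sum. -/
theorem doubleField_undouble_of_const (ε : ZMod 2) {D : Der K (superShear ι N)}
    (hD : D ∈ vectDeg K (superShear ι N) (-1)) (hD' : D ∈ vectParity (κ := ι) N ε) :
    doubleField N ε (undouble N D) = D := by
  have hconst : ∀ {f : truncated K (superShear ι N)},
      f ∈ homog K (superShear ι N) (fun _ => (1 : ℤ)) 0 →
      double K N (evenRestrict K N f) = f := fun {f} hf => by
    have h1 : evenRestrict K N 1 = 1 := by
      rw [← map_one (double K N), evenRestrict_double]
    rw [eq_smul_one_of_homog hf, map_smul, h1, map_smul, map_one]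
  refine vect_ext (doubleField_parity _ _) hD' fun k => ?_
  rw [doubleField_z, undouble_z, zSum, map_add, hconst (add_mem (hD.2 _) (hD.2 _)), map_add]
  rcases k with i | i
  · change _ + parityProj K N _ (D (z K _ (Sum.inr i))) = D _
    rw [homogProj_of_mem_ne (by simp [parity]) (hD'.2 (Sum.inr i)), add_zero]
    exact homogProj_of_mem (hD'.2 _)
  · change parityProj K N _ (D (z K _ (Sum.inl i))) + _ = D _
    rw [homogProj_of_mem_ne (by simp [parity]) (hD'.2 (Sum.inl i)), zero_add]
    exact homogProj_of_mem (hD'.2 _)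

theorem pd_zSum (i j : ι) : pd K (superShear ι N) (Sum.inl i) (zSum K N j) =
    if i = j then 1 else 0 := by
  rw [zSum, map_add, pd_z, pd_z]
  by_cases h : i = j <;> simp [h]

/-- At x_k + ξ_k a bracket with ∂/∂x_i amounts to minus the derivative of the coefficient, because
derivations kill the constant ∂/∂x_i (x_k + ξ_k). Thus the vanishing double bracket says that the
second derivative of D(x_k + ξ_k) in x_i is zero, which is what `pd_evenRestrict` requires. -/
theorem undouble_lie_pd (i : ι) {d : ℤ} {D : Der K (superShear ι N)}
    (hD : D ∈ vectDeg K (superShear ι N) d)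
    (h : ⁅⁅D, pd K (superShear ι N) (Sum.inl i)⁆, pd K (superShear ι N) (Sum.inl i)⁆ = 0) :
    ⁅undouble N D, pd K (shearOne ι) i⁆ =
      undouble N ⁅D, pd K (superShear ι N) (Sum.inl i)⁆ := by
  refine vect_ext (lie_mem_vect (undouble_degree hD) (pd_mem_vect (fun _ => (1 : ℤ)) i))
    (undouble_degree (lie_mem_vect hD (pd_mem_vect (fun _ => (1 : ℤ)) _))) fun k => ?_
  have hconst : ∀ {κ : Type _} [Fintype κ] [DecidableEq κ] {N : κ → WithTop ℕ+} (E : Der K N)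
      (p : Prop) [Decidable p], E (if p then 1 else 0) = 0 := fun E p _ => by
    split_ifs
    · exact Derivation.map_one_eq_zero E
    · exact map_zero E
  have h2 : pd K (superShear ι N) (Sum.inl i) (pd K (superShear ι N) (Sum.inl i)
      (D (zSum K N k))) = 0 := by
    have := congrArg (fun E : Der K (superShear ι N) => E (zSum K N k)) h
    rw [Derivation.commutator_apply, Derivation.commutator_apply, Derivation.commutator_apply,
      pd_zSum, hconst D, hconst (pd K _ _), map_zero, zero_sub, zero_sub, map_zero, neg_zero,
      zero_sub, map_neg, neg_neg, Derivation.zero_apply] at this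
    exact this
  rw [Derivation.commutator_apply, pd_z, hconst, undouble_z, pd_evenRestrict i h2, undouble_z,
    Derivation.commutator_apply, pd_zSum, hconst, zero_sub, zero_sub, map_neg]

end DoubleField

/-! ### Doubles of constant and linear fields -/

section Iso

variable {K : Type*} [Field K] [CharP K 2] (L : Type*) [LieRing L] [LieAlgebra K L]
  [TwoStructure K L] {V : Type*} [AddCommGroup V] [Module K V] [LieRingModule L V]
  [LieModule K L V] [IsRestrictedModule K L V]
  {ι : Type*} [Fintype ι] [DecidableEq ι] (b : Module.Basis ι K V) (N : ι → WithTop ℕ+)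

theorem eq_of_lie_pd_eq {κ : Type*} [Fintype κ] [DecidableEq κ] {N : κ → WithTop ℕ+} {d : ℤ}
    (hd : 0 ≤ d) {D E : Der K N} (hD : D ∈ vectDeg K N d) (hE : E ∈ vectDeg K N d)
    (h : ∀ i, ⁅D, pd K N i⁆ = ⁅E, pd K N i⁆) : D = E :=
  sub_eq_zero.1 (eq_zero_of_lie_pd hd (sub_mem hD hE) fun i =>
    (sub_lie D E (pd K N i)).trans (sub_eq_zero.2 (h i)))

theorem parityProj_zSum_zero (i : ι) :
    parityProj K N 0 (zSum K N i) = z K (superShear ι N) (Sum.inl i) := by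
  rw [zSum, map_add, homogProj_of_mem (d := 0) (z_mem_homog (parity ι ι) (Sum.inl i)),
    homogProj_of_mem_ne (e := 1) (by decide) (z_mem_homog (parity ι ι) (Sum.inr i)), add_zero]

theorem parityProj_zSum_one (i : ι) :
    parityProj K N 1 (zSum K N i) = z K (superShear ι N) (Sum.inr i) := by
  rw [zSum, map_add, homogProj_of_mem_ne (e := 0) (by decide) (z_mem_homog (parity ι ι) (Sum.inl i)),
    homogProj_of_mem (d := 1) (z_mem_homog (parity ι ι) (Sum.inr i)), zero_add]

/-- The coefficients are linear forms in the x_i + ξ_i. The even projection keeps x_i in the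
coefficients at ∂/∂x_k and ξ_i in those at ∂/∂ξ_k: two diagonal copies of the matrix of x, which is
the action of x on V ⊕ Π(V). -/
theorem doubleField_zero_actField (x : L) :
    doubleField N 0 (actField L b x) = evenField L b (piBasis b) N x := by
  refine vect_ext (doubleField_parity _ _) (evenField_parity L b (piBasis b) N x) fun k => ?_
  rw [doubleField_z]
  refine Eq.trans ?_ (linField_z _ _ k).symm
  rw [show actField L b x = linField (shearOne ι) b (LieModule.toEnd K L V x) from rfl, linField_z]
  simp only [map_sum, map_smul, double_z]
  rw [Fintype.sum_sum_type]
  rcases k with k | k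
  · simp only [parity, Sum.elim_inl, add_zero, parityProj_zSum_zero]
    simp [evenOp, index]
  · simp only [parity, Sum.elim_inr, zero_add, parityProj_zSum_one]
    simp [evenOp, index]
    rfl

/-- For ε = 1 the roles of x_i and ξ_i are exchanged, and the matrix of x appears in both
off-diagonal blocks, as in the action of Π(x). -/
theorem doubleField_one_actField (x : L) :
    doubleField N 1 (actField L b x) =
      oddField L (ParityShift L) b (piBasis b) N (toPi x) := by
  refine vect_ext (doubleField_parity _ _)
    (oddField_parity L (ParityShift L) b (piBasis b) N (toPi x)) fun k => ?_
  rw [doubleField_z]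
  refine Eq.trans ?_ (linField_z _ _ k).symm
  rw [show actField L b x = linField (shearOne ι) b (LieModule.toEnd K L V x) from rfl, linField_z]
  simp only [map_sum, map_smul, double_z]
  rw [Fintype.sum_sum_type]
  rcases k with k | k
  · simp only [parity, Sum.elim_inl, add_zero, parityProj_zSum_one]
    simp [oddOp, index]
    rfl
  · simp only [parity, Sum.elim_inr, CharTwo.add_self_eq_zero, parityProj_zSum_zero]
    simp [oddOp, index]
    rfl

theorem doubleField_zero_constField (v : V) :
    doubleField N 0 (constField (shearOne ι) b v) =
      constField (superShear ι N) (b.prod (piBasis b)) (v, 0) := by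
  change doubleField N 0 (∑ j, b.repr v j • pd K (shearOne ι) j) =
    ∑ j, (b.prod (piBasis b)).repr (v, 0) j • pd K (superShear ι N) j
  rw [Fintype.sum_sum_type, map_sum]
  have h : ∀ j, doubleField N 0 (pd K (shearOne ι) j) = pd K (superShear ι N) (Sum.inl j) :=
    fun j => doubleField_pd (N := N) (Sum.inl j)
  simp [h]

theorem doubleField_one_constField (v : V) :
    doubleField N 1 (constField (shearOne ι) b v) =
      constField (superShear ι N) (b.prod (piBasis b)) (0, toPi v) := by
  change doubleField N 1 (∑ j, b.repr v j • pd K (shearOne ι) j) =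
    ∑ j, (b.prod (piBasis b)).repr (0, toPi v) j • pd K (superShear ι N) j
  rw [Fintype.sum_sum_type, map_sum]
  have h : ∀ j, doubleField N 1 (pd K (shearOne ι) j) = pd K (superShear ι N) (Sum.inr j) :=
    fun j => doubleField_pd (N := N) (Sum.inr j)
  simp [h]
  rfl

/-! ### Comparison of the homogeneous components -/

theorem vectDeg_le_vectAll {κ : Type*} [Fintype κ] [DecidableEq κ] {N : κ → WithTop ℕ+} {d : ℤ}
    {D : Der K N} (hD : D ∈ vectDeg K N d) : D ∈ vectAll K N := hD.1

theorem cartanComponent_degree {n : ℕ} {D : Der K (shearOne ι)} (hD : D ∈ cartanComponent L b n) :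
    D ∈ vectDeg K (shearOne ι) (n - 1) := prolong_le (actField_le L b) n hD

theorem cartanComponent_vectAll {n : ℕ} {D : Der K (shearOne ι)}
    (hD : D ∈ cartanComponent L b n) : D ∈ vectAll K (shearOne ι) :=
  vectDeg_le_vectAll (cartanComponent_degree L b hD)

theorem pd_mem_vectAll (i : ι) : pd K (shearOne ι) i ∈ vectAll K (shearOne ι) :=
  vectDeg_le_vectAll (pd_mem_vect (fun _ => (1 : ℤ)) i)

theorem cartanProlong_vectAll {D : Der K (shearOne ι)} (hD : D ∈ CartanProlong L b) :
    D ∈ vectAll K (shearOne ι) :=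
  (iSup_le fun _ _ hD => cartanComponent_vectAll L b hD :
    ⨆ n, cartanComponent L b n ≤ vectAll K (shearOne ι)) hD

theorem lie_vectAll_pd {n : ℕ} {D : Der K (shearOne ι)} (hD : D ∈ cartanComponent L b n) (i : ι) :
    ⁅D, pd K (shearOne ι) i⁆ ∈ vectAll K (shearOne ι) :=
  vectDeg_le_vectAll
    (lie_mem_vect (cartanComponent_degree L b hD) (pd_mem_vect (fun _ => (1 : ℤ)) i))

theorem doubleField_lie_pd (ε : ZMod 2) {D : Der K (shearOne ι)}
    (hD : D ∈ vectAll K (shearOne ι)) (k : ι ⊕ ι) :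
    ⁅doubleField N ε D, pd K (superShear ι N) k⁆ =
      doubleField N (ε + parity ι ι k) ⁅D, pd K (shearOne ι) (index k)⁆ := by
  rw [← doubleField_pd k, doubleField_lie _ _ hD (pd_mem_vectAll _)]

theorem doubleField_mem_superComponent (n : ℕ) : ∀ (ε : ZMod 2), ∀ D ∈ cartanComponent L b n,
    doubleField N ε D ∈ superComponent L (ParityShift L) b (piBasis b) N n := by
  induction n using Nat.strong_induction_on with
  | h n ih =>
    intro ε D hD
    match n, hD with
    | 0, hD => exact doubleField_degree ε hD
    | 1, hD =>
      obtain ⟨x, rfl⟩ := hD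
      rcases zmod_two_cases ε 0 with rfl | rfl
      · rw [doubleField_zero_actField]
        exact Submodule.mem_sup_left ⟨x, rfl⟩
      · rw [zero_add, doubleField_one_actField]
        exact Submodule.mem_sup_right ⟨toPi x, rfl⟩
    | n + 2, hD =>
      refine mem_prolong_add_two.2 ⟨doubleField_degree ε hD.1, fun k => ?_⟩
      -- The bracket with ∂_k is a double whose parity is shifted by that of k, so the induction has
      -- to run over both parities at once.
      rw [doubleField_lie_pd N ε (vectDeg_le_vectAll hD.1)]
      exact ih (n + 1) (by omega) _ _ (hD.2 _)

theorem lie_pd_pd {κ : Type*} [Fintype κ] [DecidableEq κ] {N : κ → WithTop ℕ+} (D : Der K N)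
    (i j : κ) : ⁅⁅D, pd K N i⁆, pd K N j⁆ = ⁅⁅D, pd K N j⁆, pd K N i⁆ := by
  refine Derivation.ext fun f => ?_
  simp only [Derivation.commutator_apply, map_sub]
  rw [pd_comm i j f, pd_comm i j (D f)]
  abel

/-- In characteristic 2 the double bracket with ∂_i is the commutator with ∂_i², and ∂_i² = 0 when
exponents of z_i are at most 1. It is applied to the odd indeterminates. -/
theorem lie_pd_pd_self {κ : Type*} [Fintype κ] [DecidableEq κ] {N : κ → WithTop ℕ+} (D : Der K N)
    {i : κ} (hi : N i = 1) : ⁅⁅D, pd K N i⁆, pd K N i⁆ = 0 := by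
  refine Derivation.ext fun f => ?_
  simp only [Derivation.commutator_apply, map_sub]
  rw [pd_pd_of_one i hi f, pd_pd_of_one i hi (D f), map_zero, zero_sub, sub_zero,
    sub_eq_add_neg, add_self K]
  rfl

/-- Surjectivity of doubling in each degree and parity. The odd derivatives ∂/∂ξ_i force the
dependence of D on x_i to be as restricted as that on ξ_i, whatever N_i is. -/
theorem doubleField_undouble_of_mem (n : ℕ) : ∀ (ε : ZMod 2),
    ∀ D ∈ superComponent L (ParityShift L) b (piBasis b) N n, D ∈ vectParity (κ := ι) N ε →
      undouble N D ∈ cartanComponent L b n ∧ doubleField N ε (undouble N D) = D := by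
  induction n using Nat.strong_induction_on with
  | h n ih =>
    intro ε D hD hε
    match n, hD with
    | 0, hD => exact ⟨undouble_degree hD, doubleField_undouble_of_const ε hD hε⟩
    | 1, hD =>
      suffices h : ∃ x, D = doubleField N ε (actField L b x) by
        obtain ⟨x, rfl⟩ := h
        have hx : actField L b x ∈ cartanComponent L b 1 := ⟨x, rfl⟩
        rw [undouble_doubleField ε (cartanComponent_vectAll L b hx)]
        exact ⟨hx, rfl⟩
      -- In degree 0, D is the sum of an even and an odd linear field; as D is homogeneous, the
      -- summand of the wrong parity is the zero field (although the element that it represents need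
      -- not be zero).
      obtain ⟨_, ⟨e, rfl⟩, _, ⟨x, rfl⟩, rfl⟩ := Submodule.mem_sup.1 hD
      rcases zmod_two_cases ε 0 with rfl | rfl
      · refine ⟨e, ?_⟩
        rw [doubleField_zero_actField, add_eq_left]
        refine eq_zero_of_vect (d := (1 : ZMod 2)) (e := 0) (by decide)
          (oddField_parity L (ParityShift L) b (piBasis b) N x) ?_
        have := sub_mem hε (evenField_parity L b (piBasis b) N e)
        rwa [add_sub_cancel_left] at this
      · rw [zero_add] at hε ⊢
        refine ⟨(x : L), Eq.trans ?_ (doubleField_one_actField L b N (x : L)).symm⟩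
        refine add_eq_right.2 ?_
        refine eq_zero_of_vect (d := (0 : ZMod 2)) (e := 1) (by decide)
          (evenField_parity L b (piBasis b) N e) ?_
        have := sub_mem hε (oddField_parity L (ParityShift L) b (piBasis b) N x)
        rwa [add_sub_cancel_right] at this
    | n + 2, hD =>
      set E : ι ⊕ ι → Der K (shearOne ι) := fun k => undouble N ⁅D, pd K (superShear ι N) k⁆
      have key : ∀ k, E k ∈ cartanComponent L b (n + 1) ∧
          doubleField N (ε + parity ι ι k) (E k) = ⁅D, pd K (superShear ι N) k⁆ := fun k => by
        refine ih (n + 1) (by omega) _ _ (hD.2 k) ?_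
        have := lie_mem_vect hε (pd_mem_vect (parity ι ι) k)
        rwa [CharTwo.neg_eq] at this
      -- The identity [[D, ∂_k], ∂_l] = [[D, ∂_l], ∂_k] between doubles of the same parity descends
      -- to V because `undouble` is a left inverse of doubling.
      have hsymm : ∀ k l, ⁅E k, pd K (shearOne ι) (index l)⁆ =
          ⁅E l, pd K (shearOne ι) (index k)⁆ := fun k l => by
        have h := lie_pd_pd D k l
        rw [← (key k).2, ← (key l).2,
          doubleField_lie_pd N _ (cartanComponent_vectAll L b (key k).1),
          doubleField_lie_pd N _ (cartanComponent_vectAll L b (key l).1),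
          add_right_comm ε (parity ι ι l)] at h
        have h' := congrArg (undouble N) h
        rwa [undouble_doubleField _ (lie_vectAll_pd L b (key k).1 _),
          undouble_doubleField _ (lie_vectAll_pd L b (key l).1 _)] at h'
      have heq : ∀ i, E (Sum.inl i) = E (Sum.inr i) := fun i => by
        have hdeg : ∀ k, E k ∈ vectDeg K (shearOne ι) n := fun k => by
          have := cartanComponent_degree L b (key k).1
          rwa [show ((n + 1 : ℕ) : ℤ) - 1 = n by push_cast; ring] at this
        -- Both brackets with ∂_j are compared with [E(ξ_j), ∂_i]. The E's have degree n ≥ 0, so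
        -- equality of all brackets is enough.
        exact eq_of_lie_pd_eq (Int.natCast_nonneg n) (hdeg _) (hdeg _) fun j =>
          (hsymm (Sum.inl i) (Sum.inr j)).trans (hsymm (Sum.inr i) (Sum.inr j)).symm
      -- The vanishing is automatic for ξ_i and is carried over to x_i by E(x_i) = E(ξ_i). It
      -- supplies the hypothesis of `undouble_lie_pd`.
      have hsq : ∀ i, ⁅⁅D, pd K (superShear ι N) (Sum.inl i)⁆,
          pd K (superShear ι N) (Sum.inl i)⁆ = 0 := fun i => by
        have h0 : ⁅E (Sum.inr i), pd K (shearOne ι) i⁆ = 0 := by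
          have h := lie_pd_pd_self D (i := Sum.inr i) (N := superShear ι N) rfl
          rw [← (key _).2, doubleField_lie_pd N _ (cartanComponent_vectAll L b (key _).1)] at h
          have h' := congrArg (undouble N) h
          rwa [undouble_doubleField _ (lie_vectAll_pd L b (key _).1 _), map_zero] at h'
        rw [← (key _).2, doubleField_lie_pd N _ (cartanComponent_vectAll L b (key _).1), heq]
        exact (congrArg _ h0).trans (map_zero _)
      have hlie : ∀ k, ⁅undouble N D, pd K (shearOne ι) (index k)⁆ = E k := fun k => by
        have h : ∀ i, ⁅undouble N D, pd K (shearOne ι) i⁆ = E (Sum.inl i) := fun i =>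
          undouble_lie_pd i hD.1 (hsq i)
        rcases k with i | i
        · exact h i
        · exact (h i).trans (heq i)
      have hdeg : undouble N D ∈ vectDeg K (shearOne ι) (n + 1) := undouble_degree hD.1
      refine ⟨mem_prolong_add_two.2 ⟨hdeg, fun i => ?_⟩, ?_⟩
      · have := hlie (Sum.inl i)
        rw [show index (Sum.inl i) = i from rfl] at this
        rw [this]
        exact (key _).1
      -- The field D and the double of `undouble N D` have the same bracket with every ∂_k, namely
      -- the double of E k of parity ε + p(k).
      · refine eq_of_lie_pd_eq (d := n + 1) (by omega) (doubleField_degree ε hdeg) hD.1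
          fun k => ?_
        rw [doubleField_lie_pd N ε (vectDeg_le_vectAll hdeg), hlie, (key k).2]

/-! ### From components to the whole prolongs, and the isomorphism -/

theorem doubleField_mem_iSup (ε : ZMod 2) {D : Der K (shearOne ι)} (hD : D ∈ CartanProlong L b) :
    doubleField N ε D ∈
      ⨆ n, superComponent L (ParityShift L) b (piBasis b) N n ⊓ vectParity N ε :=
  (iSup_le fun n D hD => Submodule.mem_iSup_of_mem n
    ⟨doubleField_mem_superComponent L b N n ε D hD, doubleField_parity ε D⟩ :
    ⨆ n, cartanComponent L b n ≤
      (⨆ n, superComponent L (ParityShift L) b (piBasis b) N n ⊓ vectParity N ε).comap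
        (doubleField N ε)) hD

theorem undouble_mem_iSup (ε : ZMod 2) {D : Der K (superShear ι N)}
    (hD : D ∈ ⨆ n, superComponent L (ParityShift L) b (piBasis b) N n ⊓ vectParity N ε) :
    undouble N D ∈ CartanProlong L b :=
  (iSup_le fun n D hD => Submodule.mem_iSup_of_mem n
    (doubleField_undouble_of_mem L b N n ε D hD.1 hD.2).1 :
    ⨆ n, superComponent L (ParityShift L) b (piBasis b) N n ⊓ vectParity N ε ≤
      (⨆ n, cartanComponent L b n).comap (undouble N)) hD

theorem doubleField_undouble (ε : ZMod 2) {D : Der K (superShear ι N)}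
    (hD : D ∈ ⨆ n, superComponent L (ParityShift L) b (piBasis b) N n ⊓ vectParity N ε) :
    doubleField N ε (undouble N D) = D :=
  (iSup_le fun n D hD => (doubleField_undouble_of_mem L b N n ε D hD.1 hD.2).2 :
    ⨆ n, superComponent L (ParityShift L) b (piBasis b) N n ⊓ vectParity N ε ≤
      LinearMap.eqLocus (doubleField N ε ∘ₗ undouble N) LinearMap.id) hD

/-- Doubling and `undouble` each respect the components, and the second undoes the first; hence the
grading is reflected as well as preserved. -/
theorem mem_cartanComponent_iff (ε : ZMod 2) (n : ℕ) {D : Der K (shearOne ι)}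
    (hD : D ∈ CartanProlong L b) : D ∈ cartanComponent L b n ↔
      doubleField N ε D ∈ superComponent L (ParityShift L) b (piBasis b) N n := by
  refine ⟨doubleField_mem_superComponent L b N n ε D, fun h => ?_⟩
  have := (doubleField_undouble_of_mem L b N n ε _ h (doubleField_parity ε D)).1
  rwa [undouble_doubleField ε (cartanProlong_vectAll L b hD)] at this

/-- The isomorphism `𝔮((V, L)_{*, N_s}) ≃ (𝔮(V), 𝔮(L))_{*, N}`. -/
def queerProlongEquiv : LieSuperEquivTwo K
    (CartanProlong L b) (ParityShift (CartanProlong L b))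
    (SuperProlongEven L (ParityShift L) b (piBasis b) N)
    (SuperProlongOdd L (ParityShift L) b (piBasis b) N) where
  even :=
    { toFun := fun D => ⟨doubleField N 0 D.1, doubleField_mem_iSup L b N 0 D.2⟩
      map_add' := fun D E => Subtype.ext (map_add (doubleField N 0) D.1 E.1)
      map_smul' := fun c D => Subtype.ext (map_smul (doubleField N 0) c D.1)
      map_lie' := fun {D E} => Subtype.ext (doubleField_lie 0 0 (cartanProlong_vectAll L b D.2)
        (cartanProlong_vectAll L b E.2)).symm
      invFun := fun D => ⟨undouble N D.1, undouble_mem_iSup L b N 0 D.2⟩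
      left_inv := fun D => Subtype.ext (undouble_doubleField 0 (cartanProlong_vectAll L b D.2))
      right_inv := fun D => Subtype.ext (doubleField_undouble L b N 0 D.2) }
  odd :=
    { toFun := fun (D : CartanProlong L b) =>
        ⟨doubleField N 1 D.1, doubleField_mem_iSup L b N 1 D.2⟩
      map_add' := fun (D E : CartanProlong L b) =>
        Subtype.ext (map_add (doubleField N 1) D.1 E.1)
      map_smul' := fun c (D : CartanProlong L b) =>
        Subtype.ext (map_smul (doubleField N 1) c D.1)
      invFun := fun D =>
        toPi (⟨undouble N D.1, undouble_mem_iSup L b N 1 D.2⟩ : CartanProlong L b)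
      left_inv := fun (D : CartanProlong L b) =>
        Subtype.ext (undouble_doubleField 1 (cartanProlong_vectAll L b D.2))
      right_inv := fun D => Subtype.ext (doubleField_undouble L b N 1 D.2) }
  map_lie := fun D (E : CartanProlong L b) => Subtype.ext
    (doubleField_lie 0 1 (cartanProlong_vectAll L b D.2) (cartanProlong_vectAll L b E.2)).symm
  map_sq := fun (D : CartanProlong L b) =>
    Subtype.ext (derSq_doubleField (cartanProlong_vectAll L b D.2)).symm

end Iso

end

end QueerProlong

open QueerProlong
/-- `𝔮((V, L)_{*, N_s}) = (𝔮(V), 𝔮(L))_{*, N}` for every shearing vector `N`: there is an isomorphism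
of Lie superalgebras that preserves the grading and is the identity in non-positive degrees. -/
theorem mainTheorem5 {K : Type*} [Field K] [CharP K 2]
    {L : Type*} [LieRing L] [LieAlgebra K L] [TwoStructure K L]
    {V : Type*} [AddCommGroup V] [Module K V] [LieRingModule L V] [LieModule K L V]
    [IsRestrictedModule K L V]
    {ι : Type*} [Fintype ι] [DecidableEq ι] (b : Module.Basis ι K V)
    (N : ι → WithTop ℕ+) :
    ∃ φ : LieSuperEquivTwo K
        (CartanProlong L b) (ParityShift (CartanProlong L b))
        (SuperProlongEven L (ParityShift L) b (piBasis b) N)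
        (SuperProlongOdd L (ParityShift L) b (piBasis b) N),
      (∀ (n : ℕ) (D : CartanProlong L b), (D : Der K (shearOne ι)) ∈ cartanComponent L b n ↔
        (φ.even D : Der K (superShear ι N)) ∈ superComponent L (ParityShift L) b (piBasis b) N n) ∧
      (∀ (n : ℕ) (D : CartanProlong L b), (D : Der K (shearOne ι)) ∈ cartanComponent L b n ↔
        (φ.odd (toPi D) : Der K (superShear ι N)) ∈
          superComponent L (ParityShift L) b (piBasis b) N n) ∧
      (∀ v : V, φ.even (CartanProlong.ofModule L b v) =
        SuperProlongEven.ofModule L (ParityShift L) b (piBasis b) N v) ∧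
      (∀ v : V, φ.odd (toPi (CartanProlong.ofModule L b v)) =
        SuperProlongOdd.ofModule L (ParityShift L) b (piBasis b) N (toPi v)) ∧
      (∀ x : L, φ.even (CartanProlong.ofLie L b x) =
        SuperProlongEven.ofLie L (ParityShift L) b (piBasis b) N x) ∧
      (∀ x : L, φ.odd (toPi (CartanProlong.ofLie L b x)) =
        SuperProlongOdd.ofLie L (ParityShift L) b (piBasis b) N (toPi x)) := by
  exact ⟨queerProlongEquiv L b N,
    fun n D => mem_cartanComponent_iff L b N 0 n D.2,
    fun n D => mem_cartanComponent_iff L b N 1 n D.2,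
    fun v => Subtype.ext (doubleField_zero_constField b N v),
    fun v => Subtype.ext (doubleField_one_constField b N v),
    fun x => Subtype.ext (doubleField_zero_actField L b N x),
    fun x => Subtype.ext (doubleField_one_actField L b N x)⟩
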